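/- Let $C=\partial K$ be a closed convex curve in the plane, i.e. the boundary of a compact convex set $K\subset\mathbb R^2=\mathbb C$ with nonempty interior; let $L=|C|$ be its length and $c$ an arc-length parameterization of $C$, extended $L$-periodically to $\mathbb R$ (in either orientation). Suppose $C$ has constant halving distance $h$, i.e. $|c(t)-c(t+L/2)|=h$ for all $t$. Let $M$ be the midpoint curve $m(t)=\tfrac12\bigl(c(t)+c(t+L/2)\bigr)$, $0\le t\le L/2$ (a closed curve, traversed once), and let $$A(M)=\int_{\mathbb R^2}|w_M(z)|\,dz$$ be the area bounded by $M$, each region being counted with the multiplicity given by the winding number $w_M(z)$ of $M$ around $z$ (in absolute value; $w_M:=0$ on $M$). Then this integral is finite, and the area $A$ enclosed by $C$ satisfies $$A=\frac{\pi}{4}h^2-2A(M).$$ In particular $A\le\frac{\pi}{4}h^2$. For $h>0$ every circle of diameter $h$ is a closed convex curve of constant halving distance $h$ (of length $\pi h$) with area exactly $\frac{\pi}{4}h^2$, so the circle maximizes the area among closed convex curves of constant halving distance $h$. -/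

import Mathlib

open MeasureTheory Set

/-- The plane is `ℂ` with its Euclidean distance and Lebesgue measure.
`IsConvexCycle K L c`: the boundary of the compact convex set `K` with nonempty interior is a
simple closed curve of length `L`, and `c` is an arc-length parameterization of it, extended to
all of `ℝ` with period `L` (parameters are thus read modulo the length). Either orientation is
allowed. `HasUnitSpeedOn c univ` says that for `s ≤ t` the length (total variation) of `c` between
`s` and `t` is `t - s`; in particular `c` is continuous. -/
structure IsConvexCycle (K : Set ℂ) (L : ℝ) (c : ℝ → ℂ) : Prop where
  convex : Convex ℝ K
  isCompact : IsCompact K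
  interior_nonempty : (interior K).Nonempty
  length_pos : 0 < L
  periodic : Function.Periodic c L
  injOn : InjOn c (Ico 0 L)
  image_eq : c '' Ico 0 L = frontier K
  unitSpeed : HasUnitSpeedOn c univ

/-- All halving chords `c(t) c(t + L/2)` have the same length `h`. -/
def HasConstantHalvingDistance (L : ℝ) (c : ℝ → ℂ) (h : ℝ) : Prop :=
  ∀ t : ℝ, dist (c t) (c (t + L / 2)) = h

/-- The midpoint curve: the midpoints of the halving chords. It has period `L / 2`. -/
noncomputable def midpointCurve (L : ℝ) (c : ℝ → ℂ) (t : ℝ) : ℂ :=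
  (c t + c (t + L / 2)) / 2

/-- `n` is the winding number around `z` of the closed curve `γ` on `[a, b]`: the curve avoids `z`
and some continuous choice `θ` of the angle of `γ t - z` increases by `2πn` in total. -/
def IsWindingNumber (γ : ℝ → ℂ) (a b : ℝ) (z : ℂ) (n : ℤ) : Prop :=
  ∃ θ : ℝ → ℝ, ContinuousOn θ (Icc a b) ∧
    (∀ t ∈ Icc a b, γ t ≠ z ∧ γ t - z = (‖γ t - z‖ : ℂ) * Complex.exp (θ t * Complex.I)) ∧
    θ b - θ a = 2 * Real.pi * n

/-- There is at most one winding number. -/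
theorem IsWindingNumber.unique {γ : ℝ → ℂ} {a b : ℝ} (hab : a ≤ b) {z : ℂ} {n k : ℤ}
    (hn : IsWindingNumber γ a b z n) (hk : IsWindingNumber γ a b z k) : n = k := by
  obtain ⟨θ, hθ, hθ', hθn⟩ := hn
  obtain ⟨η, hη, hη', hηk⟩ := hk
  have hpi : (2 * Real.pi) ≠ 0 := by positivity
  have key : ∀ t ∈ Icc a b, ∃ j : ℤ, (θ t - η t) / (2 * Real.pi) = j := by
    intro t ht
    have h0 : (‖γ t - z‖ : ℂ) ≠ 0 := by
      have := sub_ne_zero.2 (hθ' t ht).1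
      exact_mod_cast norm_ne_zero_iff.2 this
    have h2 : Complex.exp (η t * Complex.I) = Complex.exp (θ t * Complex.I) := by
      have e := (hη' t ht).2
      have e' := (hθ' t ht).2
      exact mul_left_cancel₀ h0 (e.symm.trans e')
    obtain ⟨j, hj⟩ := Complex.exp_eq_exp_iff_exists_int.1 h2
    refine ⟨-j, ?_⟩
    have h3 : η t = θ t + j * (2 * Real.pi) := by
      have := congrArg Complex.im hj
      simpa using this
    rw [h3]; push_cast; field_simp; ring
  have hcont : ContinuousOn (fun t => (θ t - η t) / (2 * Real.pi)) (Icc a b) :=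
    (hθ.sub hη).div_const _
  have hmaps : MapsTo (fun t => (θ t - η t) / (2 * Real.pi)) (Icc a b)
      (range ((↑) : ℤ → ℝ)) := by
    intro t ht
    obtain ⟨j, hj⟩ := key t ht
    exact ⟨j, hj.symm⟩
  have hdisc : IsDiscrete (range ((↑) : ℤ → ℝ)) :=
    Int.isClosedEmbedding_coe_real.isEmbedding.isInducing.isDiscrete_range
  have heq := isPreconnected_Icc.constant_of_mapsTo hdisc hcont hmaps
    (left_mem_Icc.2 hab) (right_mem_Icc.2 hab)
  have h4 : θ a - η a = θ b - η b := by
    have := heq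
    field_simp at this
    linarith
  have h5 : 2 * Real.pi * (n : ℝ) = 2 * Real.pi * k := by linarith
  exact_mod_cast mul_left_cancel₀ hpi h5

open Classical in
/-- The winding number of the closed curve `γ` on `[a, b]` around `z`; it is `0` by convention for
`z` on the curve. -/
noncomputable def windingNumber (γ : ℝ → ℂ) (a b : ℝ) (z : ℂ) : ℤ :=
  if h : ∃ n, IsWindingNumber γ a b z n then h.choose else 0

/-- The multiplicity with which the point `z` is encircled by the midpoint curve, traversed once
(parameter interval `[0, L/2]`): the absolute value of the winding number. -/
noncomputable def midpointMultiplicity (L : ℝ) (c : ℝ → ℂ) (z : ℂ) : ℝ :=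
  |(windingNumber (midpointCurve L c) 0 (L / 2) z : ℝ)|

/-- The area bounded by the midpoint curve, each region being counted with the multiplicity of
its winding number. -/
noncomputable def midpointArea (L : ℝ) (c : ℝ → ℂ) : ℝ :=
  ∫ z : ℂ, midpointMultiplicity L c z

/-! Let `d` be half the halving chord and `m` its midpoint, so that c(t) = m - d and c(t + L/2) = m
+ d. Areas are read off from Im ∫ conj γ · γ' / 2. Adding the contributions of the two half periods
cancels the mixed terms and leaves twice the contribution of `m` plus twice that of `d` over [0,
L/2]. The chord has constant modulus h/2 and makes half a turn there, so its share is πh²/4 up to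
orientation. Green's formula `LipschitzWith.integral_windingNumber` turns the share of `m` into
twice the signed integral of its winding number.

It remains to see that this winding number has a constant sign, opposite to the orientation σ of the
cycle. Constant |d| makes d' perpendicular to `d`. Unit speed and convexity then force the tangents
at the two chord ends to have opposite normal components along the chord, so m' is parallel to `d`
and the chord turns in the sense of σ (`tangent_relations`). Seen in the frame rotating with `d`,
the point m - z crosses the chord axis only against the sense of σ, so in that sense its relative
angle gains less than π (`angle_lt_add_pi_of_ae_hasDerivAt`). The relative gain in the sense of σ is
2πσw - π, whence σw < 1 and, w being an integer, σw ≤ 0.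

All curves are merely Lipschitz, so derivatives exist only almost everywhere and absolute continuity
replaces smoothness. Green's formula comes from integrating the Cauchy kernel over a disk and
exchanging integrals. The orientation of the cycle comes from the monotone angle around an interior
point. -/

open scoped NNReal Interval ComplexConjugate

/-! ### Calculus of Lipschitz curves -/

/-- An absolutely continuous function with almost everywhere nonnegative derivative increases. -/
theorem AbsolutelyContinuousOnInterval.le_of_ae_deriv_nonneg {f : ℝ → ℝ} {a b : ℝ} (hab : a ≤ b)
    (hf : AbsolutelyContinuousOnInterval f a b) (h : ∀ᵐ t, t ∈ Ioc a b → 0 ≤ deriv f t) :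
    f a ≤ f b := by
  have h1 := hf.integral_deriv_eq_sub
  have h2 : 0 ≤ ∫ t in a..b, deriv f t := by
    rw [intervalIntegral.integral_of_le hab]
    apply setIntegral_nonneg_of_ae_restrict
    rw [Filter.EventuallyLE, ae_restrict_iff' measurableSet_Ioc]
    exact h
  linarith

theorem LipschitzWith.ae_hasDerivAt_deriv {γ : ℝ → ℂ} {C : ℝ≥0} (hγ : LipschitzWith C γ) :
    ∀ᵐ t, HasDerivAt γ (deriv γ t) t := by
  filter_upwards [hγ.ae_differentiableAt_real] with t ht using ht.hasDerivAt

/-- Integrability of the derivative of a Lipschitz curve against a continuous weight. -/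
theorem LipschitzWith.intervalIntegrable_mul_deriv {γ f : ℝ → ℂ} {C : ℝ≥0} {a b : ℝ}
    (hγ : LipschitzWith C γ) (hf : ContinuousOn f (uIcc a b)) :
    IntervalIntegrable (fun t => f t * deriv γ t) volume a b := by
  have h1 : IntervalIntegrable (deriv γ) volume a b := by
    refine (intervalIntegrable_const (c := (C : ℝ))).mono_fun
      (stronglyMeasurable_deriv γ).aestronglyMeasurable ?_
    filter_upwards with t
    simpa using norm_deriv_le_of_lipschitz hγ (x₀ := t)
  exact h1.continuousOn_mul hf

/-- A primitive of the derivative of a Lipschitz curve times a continuous weight is Lipschitz. -/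
theorem LipschitzWith.exists_lipschitzOnWith_integral_mul_deriv {γ f : ℝ → ℂ} {C : ℝ≥0} {a b : ℝ}
    (hab : a ≤ b) (hγ : LipschitzWith C γ) (hf : ContinuousOn f (Icc a b)) :
    ∃ K, LipschitzOnWith K (fun t => ∫ s in a..t, f s * deriv γ s) (Icc a b) := by
  obtain ⟨M, hM⟩ := isCompact_Icc.exists_bound_of_continuousOn hf
  have hM0 : 0 ≤ M := (norm_nonneg _).trans (hM a (left_mem_Icc.2 hab))
  refine ⟨⟨M * C, by positivity⟩, LipschitzOnWith.of_dist_le_mul fun x hx y hy => ?_⟩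
  have hsub : ∀ u ∈ Icc a b, IntervalIntegrable (fun s => f s * deriv γ s) volume a u :=
    fun u hu => hγ.intervalIntegrable_mul_deriv
      (hf.mono (by rw [uIcc_of_le hu.1]; exact Icc_subset_Icc_right hu.2))
  rw [dist_comm, dist_eq_norm,
    intervalIntegral.integral_interval_sub_left (hsub y hy) (hsub x hx), dist_comm,
    Real.dist_eq]
  refine intervalIntegral.norm_integral_le_of_norm_le_const fun t ht => ?_
  have ht' : t ∈ Icc a b := uIcc_subset_Icc hx hy (uIoc_subset_uIcc ht)
  rw [norm_mul]
  exact mul_le_mul (hM t ht') (norm_deriv_le_of_lipschitz hγ) (norm_nonneg _) hM0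

theorem AbsolutelyContinuousOnInterval.eq_of_ae_hasDerivAt_zero {f : ℝ → ℂ} {a b t : ℝ}
    (hf : AbsolutelyContinuousOnInterval f a b)
    (h : ∀ᵐ x, x ∈ uIcc a b → HasDerivAt f 0 x) (ht : t ∈ uIcc a b) : f t = f a := by
  obtain ⟨K, hK⟩ := hf.const_of_ae_hasDerivAt_zero h
  rw [hK t ht, hK a left_mem_uIcc]

theorem LipschitzWith.integral_deriv_eq_sub {γ : ℝ → ℂ} {C : ℝ≥0} {a b : ℝ} (hab : a ≤ b)
    (hγ : LipschitzWith C γ) : ∫ t in a..b, deriv γ t = γ b - γ a := by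
  have hi : IntervalIntegrable (deriv γ) volume a b := by
    simpa using hγ.intervalIntegrable_mul_deriv (f := fun _ => 1) (a := a) (b := b)
      continuousOn_const
  obtain ⟨K, hK⟩ := hγ.exists_lipschitzOnWith_integral_mul_deriv (f := fun _ => 1) hab
    continuousOn_const
  simp only [one_mul] at hK
  have h1 : AbsolutelyContinuousOnInterval γ a b :=
    (hγ.lipschitzOnWith (s := uIcc a b)).absolutelyContinuousOnInterval
  have h2 : AbsolutelyContinuousOnInterval (fun x => ∫ t in a..x, deriv γ t) a b :=
    LipschitzOnWith.absolutelyContinuousOnInterval (K := K) (by rwa [uIcc_of_le hab])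
  have h3 := (h1.sub h2).eq_of_ae_hasDerivAt_zero (t := b) (by
    filter_upwards [hγ.ae_hasDerivAt_deriv, hi.ae_hasDerivAt_integral] with t h1 h2 h3
    have := h1.sub (h2 h3 a left_mem_uIcc)
    rwa [sub_self] at this) right_mem_uIcc
  simp only [Pi.sub_apply, intervalIntegral.integral_same, sub_zero] at h3
  linear_combination -h3

/-! ### Logarithms along curves and winding numbers -/

/-- The increment from `a` to `t` of a logarithm of `γ - z`. -/
noncomputable def logIncrement (γ : ℝ → ℂ) (z : ℂ) (a t : ℝ) : ℂ :=
  ∫ s in a..t, (γ s - z)⁻¹ * deriv γ s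

theorem ContinuousOn.inv_sub_const {γ : ℝ → ℂ} {s : Set ℝ} {z : ℂ} (hγ : ContinuousOn γ s)
    (hz : ∀ t ∈ s, γ t ≠ z) : ContinuousOn (fun t => (γ t - z)⁻¹) s :=
  (hγ.sub continuousOn_const).inv₀ fun t ht => sub_ne_zero.2 (hz t ht)

theorem intervalIntegrable_logIncrement {γ : ℝ → ℂ} {C : ℝ≥0} {a b : ℝ} {z : ℂ}
    (hab : a ≤ b) (hγ : LipschitzWith C γ) (hz : ∀ t ∈ Icc a b, γ t ≠ z) :
    IntervalIntegrable (fun s => (γ s - z)⁻¹ * deriv γ s) volume a b :=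
  hγ.intervalIntegrable_mul_deriv
    (by rw [uIcc_of_le hab]; exact hγ.continuous.continuousOn.inv_sub_const hz)

theorem continuousOn_logIncrement {γ : ℝ → ℂ} {C : ℝ≥0} {a b : ℝ} {z : ℂ}
    (hab : a ≤ b) (hγ : LipschitzWith C γ) (hz : ∀ t ∈ Icc a b, γ t ≠ z) :
    ContinuousOn (logIncrement γ z a) (Icc a b) := by
  have := intervalIntegral.continuousOn_primitive_interval'
    (intervalIntegrable_logIncrement hab hγ hz) (left_mem_uIcc)
  rwa [uIcc_of_le hab] at this

theorem exists_lipschitzOnWith_logIncrement {γ : ℝ → ℂ} {C : ℝ≥0} {a b : ℝ} {z : ℂ}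
    (hab : a ≤ b) (hγ : LipschitzWith C γ) (hz : ∀ t ∈ Icc a b, γ t ≠ z) :
    ∃ K, LipschitzOnWith K (logIncrement γ z a) (Icc a b) :=
  hγ.exists_lipschitzOnWith_integral_mul_deriv hab (hγ.continuous.continuousOn.inv_sub_const hz)

/-- `logIncrement` is the increment of a logarithm. -/
theorem sub_eq_mul_exp_logIncrement {γ : ℝ → ℂ} {C : ℝ≥0} {a b : ℝ} {z : ℂ}
    (hab : a ≤ b) (hγ : LipschitzWith C γ) (hz : ∀ t ∈ Icc a b, γ t ≠ z) {t : ℝ}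
    (ht : t ∈ Icc a b) :
    γ t - z = (γ a - z) * Complex.exp (logIncrement γ z a t) := by
  have hi := intervalIntegrable_logIncrement hab hγ hz
  obtain ⟨K, hK⟩ := exists_lipschitzOnWith_logIncrement hab hγ hz
  obtain ⟨M, hM⟩ := isCompact_Icc.exists_bound_of_continuousOn
    (continuousOn_logIncrement hab hγ hz)
  -- The exponential is Lipschitz only on bounded sets; the ball of radius `M` contains all values
  -- of the logarithm.
  obtain ⟨N, hN⟩ := (Complex.contDiff_exp (𝕜 := ℝ) (n := 1)).contDiffOn.exists_lipschitzOnWith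
    one_ne_zero (convex_closedBall (0 : ℂ) M) (isCompact_closedBall _ _)
  have hE : LipschitzOnWith (N * K) (fun t => Complex.exp (-logIncrement γ z a t)) (uIcc a b) := by
    rw [uIcc_of_le hab]
    exact hN.comp (f := fun t => -logIncrement γ z a t)
      (fun x hx y hy => by simpa using hK hx hy)
      (fun t ht => by simpa using hM t ht)
  have hac1 := hE.absolutelyContinuousOnInterval
  have hac2 : AbsolutelyContinuousOnInterval (fun t => γ t - z) a b :=
    (LipschitzOnWith.absolutelyContinuousOnInterval (K := C) fun x _ y _ => by
      simpa using hγ x y)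
  have hac := hac2.fun_smul hac1
  simp only [smul_eq_mul] at hac
  -- The product (γ - z) exp(-log increment) is absolutely continuous with derivative zero almost
  -- everywhere, hence constant.
  have h1 := hac.eq_of_ae_hasDerivAt_zero (t := t) (by
    filter_upwards [hγ.ae_hasDerivAt_deriv, hi.ae_hasDerivAt_integral] with s h1 h2 h3
    have h4 : HasDerivAt (logIncrement γ z a) ((γ s - z)⁻¹ * deriv γ s) s :=
      h2 h3 a left_mem_uIcc
    have h5 := (h1.sub_const z).mul h4.neg.cexp
    have h6 : γ s - z ≠ 0 := sub_ne_zero.2 (hz s (by rwa [uIcc_of_le hab] at h3))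
    refine h5.congr_deriv ?_
    simp only [Pi.neg_apply]
    field_simp
    ring) (by rwa [uIcc_of_le hab])
  have h2 : logIncrement γ z a a = 0 := intervalIntegral.integral_same
  rw [h2, neg_zero, Complex.exp_zero, mul_one, Complex.exp_neg] at h1
  rw [← h1, mul_assoc, inv_mul_cancel₀ (Complex.exp_ne_zero _), mul_one]

/-- A continuous argument along a Lipschitz curve that avoids `z`. -/
theorem sub_eq_norm_mul_exp {γ : ℝ → ℂ} {C : ℝ≥0} {a b : ℝ} {z : ℂ}
    (hab : a ≤ b) (hγ : LipschitzWith C γ) (hz : ∀ t ∈ Icc a b, γ t ≠ z) {t : ℝ}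
    (ht : t ∈ Icc a b) :
    γ t - z = (‖γ t - z‖ : ℂ) *
      Complex.exp (((γ a - z).arg + (logIncrement γ z a t).im : ℝ) * Complex.I) := by
  have h := sub_eq_mul_exp_logIncrement hab hγ hz ht
  rw [h, norm_mul, Complex.norm_exp]
  conv_lhs => rw [← Complex.norm_mul_exp_arg_mul_I (γ a - z)]
  push_cast
  rw [mul_assoc, mul_assoc, ← Complex.exp_add, ← Complex.exp_add]
  congr 2
  conv_lhs => rw [← Complex.re_add_im (logIncrement γ z a t)]
  ring

theorem IsWindingNumber.eq_windingNumber {γ : ℝ → ℂ} {a b : ℝ} (hab : a ≤ b) {z : ℂ} {n : ℤ}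
    (h : IsWindingNumber γ a b z n) : windingNumber γ a b z = n := by
  have hex : ∃ n, IsWindingNumber γ a b z n := ⟨n, h⟩
  rw [windingNumber, dif_pos hex]
  exact IsWindingNumber.unique hab hex.choose_spec h

theorem windingNumber_of_mem {γ : ℝ → ℂ} {a b : ℝ} {z : ℂ} (h : ∃ t ∈ Icc a b, γ t = z) :
    windingNumber γ a b z = 0 := by
  rw [windingNumber, dif_neg]
  rintro ⟨n, θ, -, h', -⟩
  obtain ⟨t, ht, e⟩ := h
  exact (h' t ht).1 e

/-- On a closed curve the exponential of the total increment is 1, so the increment is a multiple of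
2πi; its imaginary part is a continuous angle. -/
theorem exists_isWindingNumber {γ : ℝ → ℂ} {C : ℝ≥0} {a b : ℝ} {z : ℂ}
    (hab : a ≤ b) (hγ : LipschitzWith C γ) (hcl : γ b = γ a) (hz : ∀ t ∈ Icc a b, γ t ≠ z) :
    ∃ n : ℤ, logIncrement γ z a b = n * (2 * Real.pi * Complex.I) ∧
      IsWindingNumber γ a b z n := by
  have h := sub_eq_mul_exp_logIncrement hab hγ hz (right_mem_Icc.2 hab)
  have h0 : γ a - z ≠ 0 := sub_ne_zero.2 (hz a (left_mem_Icc.2 hab))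
  rw [hcl] at h
  obtain ⟨n, hn⟩ := Complex.exp_eq_one_iff.1 (mul_left_cancel₀ h0 (by rw [← h, mul_one]))
  refine ⟨n, hn, fun t => (γ a - z).arg + (logIncrement γ z a t).im, ?_, fun t ht =>
    ⟨hz t ht, sub_eq_norm_mul_exp hab hγ hz ht⟩, ?_⟩
  · exact continuousOn_const.add
      (Complex.continuous_im.comp_continuousOn (continuousOn_logIncrement hab hγ hz))
  · have h2 : logIncrement γ z a a = 0 := intervalIntegral.integral_same
    simp only [hn, h2]
    simp
    ring

/-- The winding number of a closed Lipschitz curve is the total increment of the logarithm. -/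
theorem logIncrement_eq_windingNumber {γ : ℝ → ℂ} {C : ℝ≥0} {a b : ℝ} {z : ℂ}
    (hab : a ≤ b) (hγ : LipschitzWith C γ) (hcl : γ b = γ a) (hz : ∀ t ∈ Icc a b, γ t ≠ z) :
    logIncrement γ z a b = 2 * Real.pi * windingNumber γ a b z * Complex.I := by
  obtain ⟨n, hn, hw⟩ := exists_isWindingNumber hab hγ hcl hz
  rw [hw.eq_windingNumber hab, hn]
  ring

theorem isWindingNumber_windingNumber {γ : ℝ → ℂ} {C : ℝ≥0} {a b : ℝ} {z : ℂ}
    (hab : a ≤ b) (hγ : LipschitzWith C γ) (hcl : γ b = γ a) (hz : ∀ t ∈ Icc a b, γ t ≠ z) :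
    IsWindingNumber γ a b z (windingNumber γ a b z) := by
  obtain ⟨n, -, hw⟩ := exists_isWindingNumber hab hγ hcl hz
  rwa [hw.eq_windingNumber hab]

/-! ### The Cauchy kernel averaged over circles and disks -/

theorem circleIntegral_neg (f : ℂ → ℂ) (c : ℂ) (r : ℝ) :
    (∮ w in C(c, r), -f w) = -∮ w in C(c, r), f w := by
  simpa using circleIntegral.integral_const_mul (-1) f c r

/-- This is dθ = dw / (iw). The interval (-π, π) is the one used by polar coordinates, and
periodicity moves it to (0, 2π). -/
theorem intervalIntegral_circleMap_eq (f : ℂ → ℂ) {r : ℝ} (hr : 0 < r) :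
    ∫ θ in (-Real.pi)..Real.pi, f (circleMap 0 r θ) =
      -Complex.I * ∮ w in C(0, r), w⁻¹ * f w := by
  have hp : Function.Periodic (fun θ => f (circleMap 0 r θ)) (2 * Real.pi) := fun θ => by
    simp [periodic_circleMap 0 r θ]
  have h1 := hp.intervalIntegral_add_eq (-Real.pi) 0
  rw [show -Real.pi + 2 * Real.pi = Real.pi by ring, zero_add] at h1
  rw [h1, circleIntegral, ← intervalIntegral.integral_const_mul]
  refine intervalIntegral.integral_congr fun θ _ => ?_
  have h0 : circleMap 0 r θ ≠ 0 := by simpa using hr.ne'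
  simp only [deriv_circleMap, smul_eq_mul]
  field_simp
  rw [Complex.I_sq]; ring

/-- The mean of `1 / (a - w)` over the circle `|w| = r`. -/
theorem integral_inv_sub_circleMap {a : ℂ} {r : ℝ} (hr : 0 < r) (hra : r ≠ ‖a‖) :
    ∫ θ in (-Real.pi)..Real.pi, (a - circleMap 0 r θ)⁻¹ =
      if r < ‖a‖ then 2 * Real.pi * a⁻¹ else 0 := by
  rcases eq_or_ne a 0 with rfl | ha
  · rw [if_neg (by simpa using hr.le), intervalIntegral_circleMap_eq (fun w => (0 - w)⁻¹) hr]
    have h := circleIntegral.integral_sub_zpow_of_ne (n := -2) (by norm_num) 0 0 r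
    have : (∮ w in C(0, r), w⁻¹ * (0 - w)⁻¹) = -∮ w in C(0, r), (w - 0) ^ (-2 : ℤ) := by
      rw [← circleIntegral_neg]
      congr 1; ext w
      rw [zero_sub, inv_neg, sub_zero, mul_neg, neg_inj, zpow_neg, ← mul_inv]
      norm_cast
      rw [sq]
    rw [this, h]; simp
  · have hne : ∀ θ, a - circleMap 0 r θ ≠ 0 := fun θ h => hra (by
      rw [sub_eq_zero.1 h]; simp [abs_of_pos hr])
    -- From a / (a - w) = 1 - w / (w - a); the remaining contour integral is 0 or 2πi, according to
    -- whether `a` is outside or inside the circle.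
    have h1 : a * ∫ θ in (-Real.pi)..Real.pi, (a - circleMap 0 r θ)⁻¹ =
        2 * Real.pi + Complex.I * ∮ w in C(0, r), (w - a)⁻¹ := by
      have h2 := intervalIntegral_circleMap_eq (fun w => -(w * (w - a)⁻¹)) hr
      have h3 : (∮ w in C(0, r), w⁻¹ * -(w * (w - a)⁻¹)) = -∮ w in C(0, r), (w - a)⁻¹ := by
        rw [← circleIntegral_neg]
        refine circleIntegral.integral_congr hr.le fun w hw => ?_
        have hw0 : w ≠ 0 := by
          rintro rfl; simp at hw; exact hr.ne hw
        field_simp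
      rw [h3] at h2
      have h4 : (2 * Real.pi : ℂ) = ∫ θ in (-Real.pi)..Real.pi, (1 : ℂ) := by
        simp; ring
      have hc : Continuous fun θ => -(circleMap 0 r θ * (circleMap 0 r θ - a)⁻¹) :=
        ((continuous_circleMap 0 r).mul (((continuous_circleMap 0 r).sub continuous_const).inv₀
          fun θ h => hne θ (by rw [← neg_sub, neg_eq_zero]; exact h))).neg
      have h5 : Complex.I * (∮ w in C(0, r), (w - a)⁻¹) =
          ∫ θ in (-Real.pi)..Real.pi, -(circleMap 0 r θ * (circleMap 0 r θ - a)⁻¹) := by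
        rw [h2]; ring
      rw [h5, h4, ← intervalIntegral.integral_add (by simp) (hc.intervalIntegrable _ _),
        ← intervalIntegral.integral_const_mul]
      refine intervalIntegral.integral_congr fun θ _ => ?_
      have h6 := hne θ
      have h7 : circleMap 0 r θ - a ≠ 0 := fun h => hne θ (by rw [← neg_sub, h, neg_zero])
      rw [show circleMap 0 r θ - a = -(a - circleMap 0 r θ) by ring, inv_neg]
      field_simp
      ring
    rcases lt_or_gt_of_ne hra with h | h
    · rw [if_pos h]
      have h2 : (∮ w in C(0, r), (w - a)⁻¹) = 0 := by
        apply Complex.circleIntegral_eq_zero_of_differentiable_on_off_countable hr.le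
          countable_empty
        · intro w hw
          refine ((continuousAt_id.sub continuousAt_const).inv₀ ?_).continuousWithinAt
          intro h0
          rw [← show w = a from sub_eq_zero.1 h0] at h
          simp at hw; linarith
        · intro w hw
          refine (differentiableAt_id.sub (differentiableAt_const _)).inv ?_
          intro h0
          rw [← show w = a from sub_eq_zero.1 h0] at h
          simp at hw; linarith
      rw [h2, mul_zero, add_zero] at h1
      field_simp
      rw [← h1]; ring_nf
    · rw [if_neg h.not_gt]
      rw [circleIntegral.integral_sub_inv_of_mem_ball (by simpa using h)] at h1
      have : a * ∫ θ in (-Real.pi)..Real.pi, (a - circleMap 0 r θ)⁻¹ = 0 := by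
        rw [h1]; linear_combination (2 * Real.pi : ℂ) * Complex.I_mul_I
      exact (mul_eq_zero.1 this).resolve_left ha

theorem locallyIntegrable_inv_complex : LocallyIntegrable (fun z : ℂ => z⁻¹) volume := by
  refine locallyIntegrable_of_norm_le_rpow (C := 1) (α := 1) (by simp) (by simp) ?_
    measurable_inv.aestronglyMeasurable
  filter_upwards with z
  rw [norm_inv, Real.rpow_neg_one, one_mul]

theorem integrableOn_inv_sub (a : ℂ) (R : ℝ) :
    IntegrableOn (fun z => (a - z)⁻¹) (Metric.ball 0 R) := by
  have h : IntegrableOn (fun z : ℂ => z⁻¹) (Metric.ball a R) :=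
    (locallyIntegrable_inv_complex.integrableOn_isCompact
      (isCompact_closedBall a R)).mono_set Metric.ball_subset_closedBall
  rw [← integrable_indicator_iff Metric.isOpen_ball.measurableSet] at h ⊢
  have h2 := h.comp_sub_left a
  refine h2.congr (Filter.Eventually.of_forall fun z => ?_)
  simp only [indicator]
  congr 1
  simp [dist_eq_norm]

/-- Translating by `a` keeps the disk inside the one of radius 2R. The bound is uniform in `a`,
which is what the exchange of integrals in Green's formula needs. -/
theorem integral_norm_inv_sub_le {a : ℂ} {R : ℝ} (ha : ‖a‖ < R) :
    ∫ z in Metric.ball 0 R, ‖(a - z)⁻¹‖ ≤ ∫ z in Metric.ball (0 : ℂ) (2 * R), ‖z⁻¹‖ := by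
  have h : IntegrableOn (fun z : ℂ => z⁻¹) (Metric.ball 0 (2 * R)) :=
    (locallyIntegrable_inv_complex.integrableOn_isCompact
      (isCompact_closedBall 0 (2 * R))).mono_set Metric.ball_subset_closedBall
  have e : ∫ z in Metric.ball 0 R, ‖(a - z)⁻¹‖ = ∫ z in Metric.ball a R, ‖z⁻¹‖ := by
    rw [← integral_indicator Metric.isOpen_ball.measurableSet,
      ← integral_indicator Metric.isOpen_ball.measurableSet, ← integral_sub_left_eq_self _ _ a]
    congr 1; ext z
    simp only [indicator, sub_sub_cancel]
    congr 1
    simp [dist_eq_norm, norm_sub_rev]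
  rw [e]
  refine setIntegral_mono_set h.norm (Filter.Eventually.of_forall fun z => norm_nonneg _) ?_
  refine (Metric.ball_subset_ball' ?_).eventuallyLE
  simp only [dist_zero_right]; linarith

/-- Newton's theorem in the plane: the field of a uniform disk at an interior point. -/
theorem integral_inv_sub_ball {a : ℂ} {R : ℝ} (ha : ‖a‖ < R) :
    ∫ z in Metric.ball 0 R, (a - z)⁻¹ = Real.pi * (starRingEnd ℂ) a := by
  have hm : MeasurableSet (Metric.ball (0 : ℂ) R) := Metric.isOpen_ball.measurableSet
  have hint := integrableOn_inv_sub a R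
  rw [← integrable_indicator_iff hm] at hint
  rw [← integral_indicator hm]
  set F : ℂ → ℂ := (Metric.ball 0 R).indicator fun z => (a - z)⁻¹ with hF
  have hFm : Measurable F :=
    (measurable_inv.comp (measurable_const.sub measurable_id)).indicator hm
  rw [← Complex.integral_comp_polarCoord_symm]
  have hsymm : ∀ p : ℝ × ℝ, Complex.polarCoord.symm p = circleMap 0 p.1 p.2 := fun p => by
    rw [Complex.polarCoord_symm_apply, circleMap, zero_add, Complex.exp_mul_I]
    push_cast; ring
  simp only [hsymm]
  have hG : Measurable fun p : ℝ × ℝ => p.1 • F (circleMap 0 p.1 p.2) := by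
    refine measurable_fst.smul (hFm.comp ?_)
    apply Continuous.measurable
    simp only [circleMap]
    fun_prop
  have hpt : polarCoord.target = Ioi (0 : ℝ) ×ˢ Ioo (-Real.pi) Real.pi := rfl
  have hGi : IntegrableOn (fun p : ℝ × ℝ => p.1 • F (circleMap 0 p.1 p.2))
      (Ioi (0 : ℝ) ×ˢ Ioo (-Real.pi) Real.pi) (volume.prod volume) := by
    refine ⟨hG.aestronglyMeasurable, ?_⟩
    have h := Complex.lintegral_comp_polarCoord_symm fun z => ‖F z‖ₑ
    rw [hasFiniteIntegral_iff_enorm]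
    refine lt_of_eq_of_lt ?_ hint.2
    rw [← h, hpt, ← Measure.volume_eq_prod]
    refine setLIntegral_congr_fun (measurableSet_Ioi.prod measurableSet_Ioo) fun p hp => ?_
    simp only [hsymm, enorm_smul, smul_eq_mul]
    congr 1
    rw [Real.enorm_eq_ofReal (le_of_lt hp.1)]
  rw [hpt, Measure.volume_eq_prod, setIntegral_prod _ hGi]
  -- Only circles of radius r < |a| contribute, each 2πr/a. They sum to π|a|²/a, which is π conj a.
  have hinner : ∀ r ∈ Ioi (0 : ℝ), r ≠ ‖a‖ →
      ∫ θ in Ioo (-Real.pi) Real.pi, r • F (circleMap 0 r θ) =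
        (Ioo 0 ‖a‖).indicator (fun r => (r : ℂ) * (2 * Real.pi * a⁻¹)) r := by
    intro r hr hra
    have hr' : 0 < r := hr
    rw [integral_smul, ← integral_Ioc_eq_integral_Ioo,
      ← intervalIntegral.integral_of_le (by linarith [Real.pi_pos])]
    have hball : ∀ θ, circleMap 0 r θ ∈ Metric.ball (0 : ℂ) R ↔ r < R := fun θ => by
      simp [abs_of_pos hr']
    by_cases hR : r < R
    · have e : ∀ θ, F (circleMap 0 r θ) = (a - circleMap 0 r θ)⁻¹ := fun θ =>
        indicator_of_mem ((hball θ).2 hR) _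
      simp only [e, integral_inv_sub_circleMap hr' hra, indicator, mem_Ioo, hr', true_and]
      split_ifs <;> simp
    · have e : ∀ θ, F (circleMap 0 r θ) = 0 := fun θ =>
        indicator_of_notMem (fun h => hR ((hball θ).1 h)) _
      rw [indicator_of_notMem (fun h => hR (h.2.trans ha))]
      simp [e]
  have hae : ∀ᵐ r : ℝ, r ≠ ‖a‖ := by simp [ae_iff, measure_singleton]
  rw [setIntegral_congr_ae (g := (Ioo 0 ‖a‖).indicator
    (fun r => (r : ℂ) * (2 * Real.pi * a⁻¹))) measurableSet_Ioi
    (by filter_upwards [hae] with r h1 h2 using hinner r h2 h1)]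
  rw [setIntegral_indicator measurableSet_Ioo,
    inter_eq_self_of_subset_right (fun x hx => hx.1), ← integral_Ioc_eq_integral_Ioo,
    ← intervalIntegral.integral_of_le (norm_nonneg a), intervalIntegral.integral_mul_const,
    intervalIntegral.integral_ofReal, integral_id]
  rcases eq_or_ne a 0 with rfl | h0
  · simp
  · push_cast
    field_simp
    rw [← Complex.mul_conj' a]
    ring

/-! ### Green's formula with winding numbers -/

theorem LipschitzWith.volume_image_eq_zero {γ : ℝ → ℂ} {C : ℝ≥0} (hγ : LipschitzWith C γ)
    (s : Set ℝ) : volume (γ '' s) = 0 := by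
  have h1 : dimH (γ '' s) < ((2 : ℝ≥0) : ENNReal) := by
    refine (hγ.dimH_image_le s).trans_lt ?_
    refine lt_of_le_of_lt (dimH_mono (subset_univ s)) ?_
    rw [Real.dimH_univ]
    norm_num
  have : (volume : Measure ℂ) ≪ Measure.hausdorffMeasure ((2 : ℝ≥0) : ℝ) := by
    have h := Measure.absolutelyContinuous_isAddHaarMeasure (volume : Measure ℂ)
      (Measure.hausdorffMeasure (Module.finrank ℝ ℂ : ℝ))
    simpa [Complex.finrank_real_complex] using h
  exact measure_zero_of_dimH_lt this h1

/-- A closed curve that stays in an open half plane does not wind around a boundary point. -/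
theorem windingNumber_eq_zero_of_re_pos {γ : ℝ → ℂ} {a b : ℝ} {z e : ℂ} (hab : a ≤ b)
    (hγ : Continuous γ) (hcl : γ b = γ a) (h : ∀ t ∈ Icc a b, 0 < (e * (γ t - z)).re) :
    windingNumber γ a b z = 0 := by
  have he : e ≠ 0 := by
    rintro rfl
    simpa using h a (left_mem_Icc.2 hab)
  apply IsWindingNumber.eq_windingNumber hab
  refine ⟨fun t => (e * (γ t - z)).arg - e.arg, ?_, fun t ht => ⟨?_, ?_⟩, ?_⟩
  · refine ContinuousOn.sub (fun t ht => ?_) continuousOn_const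
    have h1 : ContinuousAt (fun t => e * (γ t - z)) t := by fun_prop
    exact (ContinuousAt.comp (f := fun t => e * (γ t - z))
      (Complex.continuousAt_arg (Or.inl (h t ht))) h1).continuousWithinAt
  · rintro h0
    simpa [h0] using h t ht
  · have h1 := Complex.norm_mul_exp_arg_mul_I (e * (γ t - z))
    have h2 := Complex.norm_mul_exp_arg_mul_I e
    have h3 : Complex.exp (e.arg * Complex.I) ≠ 0 := Complex.exp_ne_zero _
    push_cast
    rw [sub_mul, Complex.exp_sub]
    apply mul_left_cancel₀ he
    rw [norm_mul, Complex.ofReal_mul] at h1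
    generalize Complex.exp ((e * (γ t - z)).arg * Complex.I) = E₁ at h1 ⊢
    rw [← h1]
    generalize Complex.exp (e.arg * Complex.I) = E₂ at h2 h3 ⊢
    calc (‖e‖ * ‖γ t - z‖ * E₁ : ℂ) = (‖e‖ * E₂) * (‖γ t - z‖ * (E₁ / E₂)) := by field_simp
      _ = _ := by rw [h2]
  · simp [hcl]

/-- The line through `z` perpendicular to the radius has the curve strictly on the side of the
origin. -/
theorem windingNumber_eq_zero_of_norm_lt {γ : ℝ → ℂ} {a b R : ℝ} {z : ℂ} (hab : a ≤ b)
    (hγ : Continuous γ) (hcl : γ b = γ a) (h : ∀ t ∈ Icc a b, ‖γ t‖ < R) (hz : R ≤ ‖z‖) :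
    windingNumber γ a b z = 0 := by
  refine windingNumber_eq_zero_of_re_pos (e := -(starRingEnd ℂ) z) hab hγ hcl fun t ht => ?_
  have h1 : ((starRingEnd ℂ) z * γ t).re ≤ ‖z‖ * ‖γ t‖ := by
    simpa using Complex.re_le_norm ((starRingEnd ℂ) z * γ t)
  have h2 : ((starRingEnd ℂ) z * z).re = ‖z‖ * ‖z‖ := by
    rw [mul_comm, Complex.mul_conj']; norm_cast; rw [sq]
  have h3 : 0 < ‖z‖ := lt_of_lt_of_le ((norm_nonneg _).trans_lt (h t ht)) hz
  rw [neg_mul, Complex.neg_re, mul_sub, Complex.sub_re, h2]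
  nlinarith [h t ht, mul_lt_mul_of_pos_left ((h t ht).trans_le hz) h3]

theorem measurable_inv_sub_mul_deriv {γ : ℝ → ℂ} (hγ : Continuous γ) :
    Measurable (Function.uncurry fun (t : ℝ) (z : ℂ) => (γ t - z)⁻¹ * deriv γ t) := by
  have h1 : Measurable fun p : ℝ × ℂ => γ p.1 - p.2 :=
    (hγ.measurable.comp measurable_fst).sub measurable_snd
  have h2 : Measurable fun p : ℝ × ℂ => deriv γ p.1 := (measurable_deriv γ).comp measurable_fst
  exact h1.inv.mul h2

/-- **Green's formula** with winding numbers, for closed Lipschitz curves. -/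
theorem LipschitzWith.integral_windingNumber {γ : ℝ → ℂ} {C : ℝ≥0} {a b : ℝ} (hab : a ≤ b)
    (hγ : LipschitzWith C γ) (hcl : γ b = γ a) :
    Integrable (fun z => (windingNumber γ a b z : ℝ)) ∧
      ∫ z, (windingNumber γ a b z : ℝ) =
        (∫ t in a..b, (starRingEnd ℂ) (γ t) * deriv γ t).im / 2 := by
  obtain ⟨M, hM⟩ := isCompact_Icc.exists_bound_of_continuousOn
    (hγ.continuous.continuousOn (s := Icc a b))
  -- The open disk of radius `R` contains the curve, as Newton's theorem requires, and the winding
  -- number vanishes outside it.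
  set R := M + 1 with hRdef
  have hR : ∀ t ∈ Icc a b, ‖γ t‖ < R := fun t ht => (hM t ht).trans_lt (by linarith)
  set B := Metric.ball (0 : ℂ) R with hB
  have hBm : MeasurableSet B := Metric.isOpen_ball.measurableSet
  have hfm : Measurable (Function.uncurry fun (t : ℝ) (z : ℂ) => (γ t - z)⁻¹ * deriv γ t) :=
    measurable_inv_sub_mul_deriv hγ.continuous
  have hfi : Integrable (Function.uncurry fun (t : ℝ) (z : ℂ) => (γ t - z)⁻¹ * deriv γ t)
      ((volume.restrict (uIoc a b)).prod (volume.restrict B)) := by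
    rw [integrable_prod_iff hfm.aestronglyMeasurable]
    have hsm : AEStronglyMeasurable (fun t => ∫ z in B, ‖(γ t - z)⁻¹ * deriv γ t‖)
        (volume.restrict (uIoc a b)) :=
      (hfm.norm.stronglyMeasurable.integral_prod_right
        (ν := volume.restrict B)).aestronglyMeasurable
    have hsl : ∀ t, Integrable (fun z => (γ t - z)⁻¹ * deriv γ t) (volume.restrict B) :=
      fun t => Integrable.mul_const (integrableOn_inv_sub (γ t) R) (deriv γ t)
    refine ⟨Filter.Eventually.of_forall hsl, ?_⟩
    refine Integrable.mono' (g := fun _ =>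
      (∫ z in Metric.ball (0 : ℂ) (2 * R), ‖z⁻¹‖) * C) ?_ hsm ?_
    · exact intervalIntegrable_iff.1 intervalIntegrable_const
    rw [ae_restrict_iff' measurableSet_uIoc]
    filter_upwards with t ht
    rw [uIoc_of_le hab] at ht
    rw [Real.norm_of_nonneg (integral_nonneg fun _ => norm_nonneg _)]
    simp only [Function.uncurry, norm_mul]
    rw [integral_mul_const]
    exact mul_le_mul (integral_norm_inv_sub_le (hR t (Ioc_subset_Icc_self ht)))
      (norm_deriv_le_of_lipschitz hγ) (norm_nonneg _) (integral_nonneg fun _ => norm_nonneg _)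
  have hswap := intervalIntegral_integral_swap hfi
  have hw : ∀ᵐ z ∂volume.restrict B, logIncrement γ z a b =
      2 * Real.pi * windingNumber γ a b z * Complex.I := by
    refine ae_restrict_of_ae ?_
    have h0 : ∀ᵐ z, z ∉ γ '' Icc a b := measure_eq_zero_iff_ae_notMem.1
      (hγ.volume_image_eq_zero _)
    filter_upwards [h0] with z hz
    exact logIncrement_eq_windingNumber hab hγ hcl fun t ht h => hz ⟨t, ht, h⟩
  have hLi : Integrable (fun z => logIncrement γ z a b) (volume.restrict B) := by
    have := hfi.integral_prod_right
    simpa only [logIncrement, intervalIntegral.integral_of_le hab, uIoc_of_le hab,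
      Function.uncurry] using this
  have hpi := Real.pi_pos
  have hcast : ∀ z, logIncrement γ z a b = 2 * Real.pi * windingNumber γ a b z * Complex.I →
      (windingNumber γ a b z : ℝ) = (logIncrement γ z a b).im / (2 * Real.pi) := fun z h => by
    rw [h]; simp
  have hind : (fun z => (windingNumber γ a b z : ℝ)) =
      B.indicator fun z => (windingNumber γ a b z : ℝ) := by
    ext z
    by_cases hz : z ∈ B
    · rw [indicator_of_mem hz]
    · rw [indicator_of_notMem hz, windingNumber_eq_zero_of_norm_lt hab hγ.continuous hcl hR
        (by simpa [hB] using hz)]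
      simp
  rw [hind, integrable_indicator_iff hBm, integral_indicator hBm]
  have hae : (fun z => (logIncrement γ z a b).im / (2 * Real.pi)) =ᵐ[volume.restrict B]
      fun z => (windingNumber γ a b z : ℝ) := by
    filter_upwards [hw] with z hz using (hcast z hz).symm
  refine ⟨(hLi.im.div_const _).congr hae, ?_⟩
  rw [← integral_congr_ae hae, integral_div]
  have him : ∫ z in B, (logIncrement γ z a b).im = (∫ z in B, logIncrement γ z a b).im :=
    integral_im hLi
  -- Exchanging the integrals leaves ∫ over `B` of 1 / (γ t - z), which is π conj (γ t). The other
  -- side is 2πi times the integral of the winding number.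
  have h1 : ∫ z in B, logIncrement γ z a b =
      Real.pi * ∫ t in a..b, (starRingEnd ℂ) (γ t) * deriv γ t := by
    simp only [logIncrement]
    rw [← hswap, ← intervalIntegral.integral_const_mul]
    refine intervalIntegral.integral_congr fun t ht => ?_
    rw [uIcc_of_le hab] at ht
    rw [integral_mul_const, integral_inv_sub_ball (hR t ht), mul_assoc]
  rw [him, h1, Complex.im_ofReal_mul]
  field_simp

/-! ### Angles that do not repeat modulo 2π -/

/-- A continuous function on `[0, L]` that takes congruent values modulo `2π` only at the endpoints
is monotone, and its total increment is `± 2π`. -/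
theorem exists_sign_of_injOn_mod_two_pi {f : ℝ → ℝ} {L : ℝ} {n : ℤ} (hL : 0 < L)
    (hf : ContinuousOn f (Icc 0 L)) (hn : f L - f 0 = 2 * Real.pi * n)
    (h : ∀ s ∈ Ico 0 L, ∀ t ∈ Ico 0 L, ∀ k : ℤ, f s - f t = 2 * Real.pi * k → s = t) :
    ∃ σ : ℤ, (σ = 1 ∨ σ = -1) ∧ n = σ ∧ MonotoneOn (fun t => σ * f t) (Icc 0 L) := by
  have hpi := Real.pi_pos
  have h0 : (0 : ℝ) ∈ Ico 0 L := ⟨le_rfl, hL⟩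
  have hn0 : n ≠ 0 := by
    rintro rfl
    have hL2 : L / 2 ∈ Ico 0 L := ⟨by linarith, by linarith⟩
    simp only [Int.cast_zero, mul_zero] at hn
    have hmid : f (L / 2) ≠ f 0 := fun e => by
      have := h _ hL2 _ h0 0 (by simp [e])
      linarith
    -- If `f` returned to its initial value, any value strictly between f 0 and f (L/2) would be
    -- taken in both halves.
    obtain ⟨v, hv, hv1, hv2⟩ : ∃ v, (v ≠ f 0 ∧ v ≠ f (L / 2)) ∧
        v ∈ f '' Icc 0 (L / 2) ∧ v ∈ f '' Icc (L / 2) L := by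
      have c1 : ContinuousOn f (Icc 0 (L / 2)) := hf.mono (Icc_subset_Icc_right hL2.2.le)
      have c2 : ContinuousOn f (Icc (L / 2) L) := hf.mono (Icc_subset_Icc_left hL2.1)
      refine ⟨(f 0 + f (L / 2)) / 2, ⟨fun e => hmid (by linarith), fun e => hmid (by linarith)⟩, ?_⟩
      rcases lt_or_gt_of_ne hmid with hlt | hlt
      · exact ⟨intermediate_value_Icc' hL2.1 c1 ⟨by linarith, by linarith⟩,
          intermediate_value_Icc hL2.2.le c2 ⟨by linarith, by linarith⟩⟩
      · exact ⟨intermediate_value_Icc hL2.1 c1 ⟨by linarith, by linarith⟩,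
          intermediate_value_Icc' hL2.2.le c2 ⟨by linarith, by linarith⟩⟩
    obtain ⟨s, hs, es⟩ := hv1
    obtain ⟨t, ht, et⟩ := hv2
    have htL : t ≠ L := by
      rintro rfl; exact hv.1 (by linarith)
    have hsL : s ≠ L / 2 := by
      rintro rfl; exact hv.2 es.symm
    have := h s ⟨hs.1, hs.2.trans_lt hL2.2⟩ t ⟨hL2.1.trans ht.1, lt_of_le_of_ne ht.2 htL⟩ 0
      (by simp [es, et])
    exact hsL (le_antisymm hs.2 (this ▸ ht.1))
  have hend : ∀ t ∈ Ico 0 L, ∀ k : ℤ, f t - f 0 = 2 * Real.pi * k → k = 0 := by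
    intro t ht k hk
    have := h t ht 0 h0 k hk
    rw [this, sub_self] at hk
    have h2 : (k : ℝ) = 0 := by
      rcases mul_eq_zero.1 hk.symm with h3 | h3
      · linarith
      · exact h3
    exact_mod_cast h2
  have hL' : ∀ t ∈ Ico 0 L, f t ≠ f L := fun t ht e => hn0 (hend t ht n (by rw [e, hn]))
  have hinj : InjOn f (Icc 0 L) := by
    intro s hs t ht e
    rcases hs.2.eq_or_lt with rfl | hs'
    · rcases ht.2.eq_or_lt with rfl | ht'
      · rfl
      · exact absurd e.symm (hL' t ⟨ht.1, ht'⟩)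
    · rcases ht.2.eq_or_lt with rfl | ht'
      · exact absurd e (hL' s ⟨hs.1, hs'⟩)
      · exact h s ⟨hs.1, hs'⟩ t ⟨ht.1, ht'⟩ 0 (by simp [e])
  have hfull : ∀ k : ℤ, f 0 + 2 * Real.pi * k ∈ f '' Icc 0 L → k = 0 ∨ k = n := by
    rintro k ⟨t, ht, e⟩
    rcases ht.2.eq_or_lt with rfl | ht'
    · right
      have : 2 * Real.pi * (k : ℝ) = 2 * Real.pi * n := by linarith
      exact_mod_cast mul_left_cancel₀ (by positivity) this
    · left
      exact hend t ⟨ht.1, ht'⟩ k (by linarith)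
  rcases hf.strictMonoOn_of_injOn_Icc' hL.le hinj with hm | hm
  · refine ⟨1, Or.inl rfl, ?_, by simpa using hm.monotoneOn⟩
    have hlt := hm (left_mem_Icc.2 hL.le) (right_mem_Icc.2 hL.le) hL
    have hn1 : (0 : ℝ) < n := by
      by_contra hc
      nlinarith
    have hn1' : (1 : ℝ) ≤ n := by
      have : 0 < n := by exact_mod_cast hn1
      exact_mod_cast this
    -- With n ≥ 1 the value f 0 + 2π is attained; only the endpoint `L` may attain it, so n = 1.
    have := hfull 1 (intermediate_value_Icc hL.le hf ⟨by push_cast; linarith, by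
      push_cast; nlinarith⟩)
    omega
  · refine ⟨-1, Or.inr rfl, ?_, ?_⟩
    · have hlt := hm (left_mem_Icc.2 hL.le) (right_mem_Icc.2 hL.le) hL
      have hn1 : (n : ℝ) < 0 := by
        by_contra hc
        nlinarith
      have hn1' : (n : ℝ) ≤ -1 := by
        have h2 : n < 0 := by exact_mod_cast hn1
        have : n ≤ -1 := by omega
        exact_mod_cast this
      have := hfull (-1) (intermediate_value_Icc' hL.le hf ⟨by push_cast; nlinarith, by
        push_cast; linarith⟩)
      omega
    · intro s hs t ht hst
      have := hm.antitoneOn hs ht hst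
      simpa using this

/-! ### Derivatives of unit speed curves -/

theorem HasUnitSpeedOn.lipschitzWith {c : ℝ → ℂ} (h : HasUnitSpeedOn c univ) :
    LipschitzWith 1 c := by
  have key : ∀ x y, x ≤ y → edist (c x) (c y) ≤ edist x y := fun x y hxy => by
    have h1 := h (mem_univ x) (mem_univ y)
    rw [univ_inter] at h1
    have h2 := eVariationOn.edist_le c (left_mem_Icc.2 hxy) (right_mem_Icc.2 hxy)
    rw [h1] at h2
    refine h2.trans_eq ?_
    rw [edist_comm, edist_dist, Real.dist_eq, abs_of_nonneg (sub_nonneg.2 hxy)]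
    simp
  intro x y
  rw [ENNReal.coe_one, one_mul]
  rcases le_total x y with hxy | hxy
  · exact key x y hxy
  · rw [edist_comm, edist_comm x]; exact key y x hxy

theorem LipschitzWith.intervalIntegrable_norm_deriv {c : ℝ → ℂ} {C : ℝ≥0}
    (hc : LipschitzWith C c) (x y : ℝ) :
    IntervalIntegrable (fun t => ‖deriv c t‖) volume x y := by
  have := (hc.intervalIntegrable_mul_deriv (f := fun _ => 1) (a := x) (b := y)
    continuousOn_const).norm
  simpa using this

/-- A curve with unit speed has derivatives of norm one almost everywhere. -/
theorem HasUnitSpeedOn.ae_norm_deriv_eq_one {c : ℝ → ℂ} (h : HasUnitSpeedOn c univ) :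
    ∀ᵐ t, ‖deriv c t‖ = 1 := by
  have hL := h.lipschitzWith
  have hle : ∀ t, ‖deriv c t‖ ≤ 1 := fun t => by simpa using norm_deriv_le_of_lipschitz hL
  set ψ : ℝ → ℝ := fun t => ∫ s in (0 : ℝ)..t, ‖deriv c s‖ with hψ
  have hsub : ∀ x y, ψ y - ψ x = ∫ s in x..y, ‖deriv c s‖ := fun x y =>
    intervalIntegral.integral_interval_sub_left (hL.intervalIntegrable_norm_deriv _ _)
      (hL.intervalIntegrable_norm_deriv _ _)
  have hmono : Monotone ψ := fun x y hxy => by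
    have : 0 ≤ ψ y - ψ x := by
      rw [hsub]
      exact intervalIntegral.integral_nonneg hxy fun _ _ => norm_nonneg _
    linarith
  have hdist : ∀ x y, x ≤ y → edist (c y) (c x) ≤ edist (ψ y) (ψ x) := fun x y hxy => by
    rw [edist_dist, edist_dist, dist_eq_norm, Real.dist_eq,
      abs_of_nonneg (sub_nonneg.2 (hmono hxy)), hsub, ← hL.integral_deriv_eq_sub hxy]
    exact ENNReal.ofReal_le_ofReal (intervalIntegral.norm_integral_le_integral_norm hxy)
  -- Hence y - x ≤ ∫ ‖c'‖ over [x, y]; since ‖c'‖ ≤ 1, equality holds almost everywhere.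
  have hvar : ∀ s : Set ℝ, eVariationOn c s ≤ eVariationOn ψ s := fun s =>
    iSup_mono fun p => Finset.sum_le_sum fun i _ => hdist _ _ (p.2.2.1 (Nat.le_succ i))
  have hint : ∀ x y, x ≤ y → ∀ᵐ t, t ∈ Ioc x y → ‖deriv c t‖ = 1 := fun x y hxy => by
    have h1 := h (mem_univ x) (mem_univ y)
    have h2 := (hmono.monotoneOn univ).eVariationOn_eq (mem_univ x) (mem_univ y)
    have h3 : ENNReal.ofReal (y - x) ≤ ENNReal.ofReal (ψ y - ψ x) := by
      rw [← h2]
      refine le_trans (le_of_eq ?_) (hvar _)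
      rw [h1]; simp
    rw [ENNReal.ofReal_le_ofReal_iff (sub_nonneg.2 (hmono hxy)), hsub] at h3
    have hi : IntervalIntegrable (fun t => 1 - ‖deriv c t‖) volume x y :=
      intervalIntegrable_const.sub (hL.intervalIntegrable_norm_deriv _ _)
    have h4 : ∫ t in x..y, (1 - ‖deriv c t‖) = 0 := by
      apply le_antisymm
      · rw [intervalIntegral.integral_sub intervalIntegrable_const
          (hL.intervalIntegrable_norm_deriv _ _)]
        simp; linarith
      · exact intervalIntegral.integral_nonneg hxy fun t _ => sub_nonneg.2 (hle t)
    rw [intervalIntegral.integral_of_le hxy, integral_eq_zero_iff_of_nonneg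
      (fun t => sub_nonneg.2 (hle t)) ((intervalIntegrable_iff_integrableOn_Ioc_of_le hxy).1 hi),
      Filter.EventuallyEq, ae_restrict_iff' measurableSet_Ioc] at h4
    filter_upwards [h4] with t ht hm
    have := ht hm
    simp only [Pi.zero_apply] at this
    linarith
  have hall : ∀ᵐ t, ∀ n : ℕ, t ∈ Ioc (-(n : ℝ)) n → ‖deriv c t‖ = 1 :=
    ae_all_iff.2 fun n => hint _ _ (by have : (0:ℝ) ≤ n := n.cast_nonneg
                                       linarith)
  filter_upwards [hall] with t ht
  obtain ⟨n, hn⟩ := exists_nat_gt |t|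
  exact ht n ⟨(abs_lt.1 hn).1, (abs_lt.1 hn).2.le⟩

/-! ### Convex cycles: orientation and enclosed area -/

namespace IsConvexCycle

variable {K : Set ℂ} {L : ℝ} {c : ℝ → ℂ}

theorem lipschitzWith (hc : IsConvexCycle K L c) : LipschitzWith 1 c :=
  hc.unitSpeed.lipschitzWith

theorem mem_frontier (hc : IsConvexCycle K L c) (t : ℝ) : c t ∈ frontier K := by
  obtain ⟨s, hs, e⟩ := hc.periodic.exists_mem_Ico₀ hc.length_pos t
  rw [e, ← hc.image_eq]
  exact mem_image_of_mem c hs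

theorem mem (hc : IsConvexCycle K L c) (t : ℝ) : c t ∈ K :=
  hc.isCompact.isClosed.frontier_subset (hc.mem_frontier t)

theorem apply_length (hc : IsConvexCycle K L c) : c L = c 0 := by
  simpa using hc.periodic 0

theorem ne_of_mem_interior (hc : IsConvexCycle K L c) {z : ℂ} (hz : z ∈ interior K) (t : ℝ) :
    c t ≠ z := by
  rintro rfl
  exact (hc.mem_frontier t).2 hz

/-- A ray from an interior point meets the boundary at most once. -/
theorem eq_of_sub_eq_smul (hc : IsConvexCycle K L c) {x y z : ℂ} (hz : z ∈ interior K)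
    (hx : x ∈ frontier K) (hy : y ∈ frontier K) {r : ℝ} (hr : 0 < r) (h : x - z = r * (y - z)) :
    x = y := by
  -- For r < 1 the point `x` is strictly between the interior point `z` and `y`, hence itself
  -- interior.
  have key : ∀ x y : ℂ, x ∈ frontier K → y ∈ frontier K → ∀ r : ℝ, 0 < r → r < 1 →
      x - z = r * (y - z) → False := by
    intro x y hx hy r h0 h1 h
    refine hx.2 (hc.convex.openSegment_interior_closure_subset_interior hz hy.1
      ⟨1 - r, r, by linarith, h0, by ring, ?_⟩)
    rw [Complex.real_smul, Complex.real_smul]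
    push_cast
    linear_combination -h
  rcases lt_trichotomy r 1 with h1 | rfl | h1
  · exact (key x y hx hy r hr h1 h).elim
  · rw [Complex.ofReal_one, one_mul] at h
    exact sub_left_inj.1 h
  · refine (key y x hy hx r⁻¹ (by positivity) (inv_lt_one_of_one_lt₀ h1) ?_).elim
    have : (r : ℂ) ≠ 0 := by exact_mod_cast hr.ne'
    rw [h]; push_cast; field_simp

/-- A curve inside `K` does not wind around points outside of `K`. -/
theorem windingNumber_eq_zero (hc : IsConvexCycle K L c) {γ : ℝ → ℂ} {a b : ℝ} (hab : a ≤ b)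
    (hγ : Continuous γ) (hcl : γ b = γ a) (hK : ∀ t, γ t ∈ K) {z : ℂ} (hz : z ∉ K) :
    windingNumber γ a b z = 0 := by
  obtain ⟨f, u, h1, h2⟩ :=
    geometric_hahn_banach_point_closed hc.convex hc.isCompact.isClosed hz
  have hf : ∀ w : ℂ, f w = f 1 * w.re + f Complex.I * w.im := fun w => by
    have e : w = w.re • (1 : ℂ) + w.im • Complex.I := by
      rw [Complex.real_smul, Complex.real_smul, mul_one, Complex.re_add_im]
    conv_lhs => rw [e, map_add, map_smul, map_smul, smul_eq_mul, smul_eq_mul]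
    ring
  -- The coefficient represents the separating functional: Re (e w) = f w.
  refine windingNumber_eq_zero_of_re_pos (e := ⟨f 1, -f Complex.I⟩) hab hγ hcl fun t _ => ?_
  have h3 : f z < f (γ t) := h1.trans (h2 _ (hK t))
  have h4 := hf (γ t - z)
  rw [map_sub] at h4
  rw [Complex.mul_re]
  simp only
  linarith

/-- Around an interior point the cycle winds monotonically, once. -/
theorem exists_sign_interior (hc : IsConvexCycle K L c) {z : ℂ} (hz : z ∈ interior K) :
    ∃ σ : ℤ, (σ = 1 ∨ σ = -1) ∧ windingNumber c 0 L z = σ ∧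
      MonotoneOn (fun t => σ * (logIncrement c z 0 t).im) (Icc 0 L) := by
  have hne : ∀ t ∈ Icc 0 L, c t ≠ z := fun t _ => hc.ne_of_mem_interior hz t
  have hL := hc.length_pos
  have hw := logIncrement_eq_windingNumber hL.le hc.lipschitzWith hc.apply_length hne
  refine exists_sign_of_injOn_mod_two_pi (f := fun t => (logIncrement c z 0 t).im) hL
    (Complex.continuous_im.comp_continuousOn
      (continuousOn_logIncrement hL.le hc.lipschitzWith hne)) ?_ fun s hs t ht k hk => ?_
  · have h0 : logIncrement c z 0 0 = 0 := intervalIntegral.integral_same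
    simp only [hw, h0]
    simp
  · apply hc.injOn hs ht
    have e1 := sub_eq_mul_exp_logIncrement hL.le hc.lipschitzWith hne (Ico_subset_Icc_self hs)
    have e2 := sub_eq_mul_exp_logIncrement hL.le hc.lipschitzWith hne (Ico_subset_Icc_self ht)
    -- Angles congruent modulo 2π put both points on one ray from `z`; the ratio of their distances
    -- is the exponential of the difference of real parts.
    refine hc.eq_of_sub_eq_smul hz (hc.mem_frontier s) (hc.mem_frontier t)
      (r := Real.exp ((logIncrement c z 0 s).re - (logIncrement c z 0 t).re))
      (Real.exp_pos _) ?_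
    rw [e1, e2, mul_left_comm, Complex.ofReal_exp, ← Complex.exp_add]
    congr 1
    rw [Complex.exp_eq_exp_iff_exists_int]
    refine ⟨k, ?_⟩
    apply Complex.ext
    · simp
    · simp only [Complex.add_im, Complex.ofReal_im, Complex.mul_im, Complex.intCast_im,
        Complex.intCast_re]
      simp
      linarith

theorem ae_sign_mul_im_nonneg {σ : ℝ} (hc : IsConvexCycle K L c) {z : ℂ} (hz : z ∈ interior K)
    (hm : MonotoneOn (fun t => σ * (logIncrement c z 0 t).im) (Icc 0 L)) :
    ∀ᵐ t, t ∈ Ioc 0 L → 0 ≤ σ * ((c t - z)⁻¹ * deriv c t).im := by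
  have hne : ∀ t ∈ Icc 0 L, c t ≠ z := fun t _ => hc.ne_of_mem_interior hz t
  have hL := hc.length_pos
  have hi := intervalIntegrable_logIncrement hL.le hc.lipschitzWith hne
  have hae : ∀ᵐ t : ℝ, t ≠ L := by simp [ae_iff, measure_singleton]
  filter_upwards [hi.ae_hasDerivAt_integral, hae] with t ht htL htm
  have hd : HasDerivAt (logIncrement c z 0) ((c t - z)⁻¹ * deriv c t) t :=
    ht (by rw [uIcc_of_le hL.le]; exact Ioc_subset_Icc_self htm) 0 left_mem_uIcc
  have hd2 : HasDerivAt (fun t => σ * (logIncrement c z 0 t).im)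
      (σ * ((c t - z)⁻¹ * deriv c t).im) t :=
    (Complex.imCLM.hasFDerivAt.comp_hasDerivAt t hd).const_mul σ
  have hnhds : Icc 0 L ∈ nhds t := Icc_mem_nhds htm.1 (lt_of_le_of_ne htm.2 htL)
  rw [← hd2.hasDerivWithinAt.derivWithin
    (uniqueDiffOn_Icc hL t (Ioc_subset_Icc_self htm))]
  exact hm.derivWithin_nonneg

/-- Areal speed is squared distance times angular speed, so both have the same sign. -/
theorem conj_mul_im_eq (w v : ℂ) : (conj w * v).im = Complex.normSq w * (w⁻¹ * v).im := by
  rcases eq_or_ne w 0 with rfl | h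
  · simp
  · rw [← Complex.im_ofReal_mul, ← mul_assoc, Complex.inv_def, mul_left_comm,
      ← Complex.ofReal_mul, mul_inv_cancel₀ (by simpa [Complex.normSq_eq_zero] using h)]
    simp

theorem integral_conj_sub_mul_deriv (hc : IsConvexCycle K L c) (z : ℂ) :
    ∫ t in (0 : ℝ)..L, conj (c t - z) * deriv c t = ∫ t in (0 : ℝ)..L, conj (c t) * deriv c t := by
  have h0 := hc.lipschitzWith.integral_deriv_eq_sub hc.length_pos.le
  rw [hc.apply_length, sub_self] at h0
  have hcc : Continuous fun t => conj (c t) :=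
    Complex.continuous_conj.comp hc.lipschitzWith.continuous
  simp only [map_sub, sub_mul]
  rw [intervalIntegral.integral_sub
    (hc.lipschitzWith.intervalIntegrable_mul_deriv hcc.continuousOn)
    (hc.lipschitzWith.intervalIntegrable_mul_deriv continuousOn_const),
    intervalIntegral.integral_const_mul, h0, mul_zero, sub_zero]

/-- The signed areal speed around `z` is at least the minimal squared distance δ times the signed
angular speed, which integrates to 2π. The integral does not involve `z`, so it ties together the
signs found at different interior points. -/
theorem sign_mul_integral_pos {σ : ℤ} (hc : IsConvexCycle K L c) {z : ℂ} (hz : z ∈ interior K)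
    (hσ : σ = 1 ∨ σ = -1) (hw : windingNumber c 0 L z = σ)
    (hm : MonotoneOn (fun t => σ * (logIncrement c z 0 t).im) (Icc 0 L)) :
    0 < σ * (∫ t in (0 : ℝ)..L, conj (c t) * deriv c t).im := by
  have hne : ∀ t ∈ Icc 0 L, c t ≠ z := fun t _ => hc.ne_of_mem_interior hz t
  have hL := hc.length_pos
  have hlip := hc.lipschitzWith
  have hw2 := logIncrement_eq_windingNumber hL.le hlip hc.apply_length hne
  obtain ⟨x, hx, hmin⟩ := isCompact_Icc.exists_isMinOn (nonempty_Icc.2 hL.le)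
    (f := fun t => Complex.normSq (c t - z))
    (Complex.continuous_normSq.comp (hlip.continuous.sub continuous_const)).continuousOn
  set δ := Complex.normSq (c x - z) with hδ
  have hδ0 : 0 < δ := Complex.normSq_pos.2 (sub_ne_zero.2 (hne x hx))
  have hi1 := intervalIntegrable_logIncrement hL.le hlip hne
  have hi2 : IntervalIntegrable (fun t => conj (c t - z) * deriv c t) volume 0 L :=
    hlip.intervalIntegrable_mul_deriv
      (Complex.continuous_conj.comp (hlip.continuous.sub continuous_const)).continuousOn
  have him : ∀ f : ℝ → ℂ, IntervalIntegrable f volume 0 L →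
      (∫ t in (0 : ℝ)..L, f t).im = ∫ t in (0 : ℝ)..L, (f t).im := fun f hf =>
    (Complex.imCLM.intervalIntegral_comp_comm hf).symm
  have hii : ∀ f : ℝ → ℂ, IntervalIntegrable f volume 0 L →
      IntervalIntegrable (fun t => (f t).im) volume 0 L := fun f hf =>
    ⟨hf.1.im, hf.2.im⟩
  have hle : ∫ t in (0 : ℝ)..L, δ * (σ * ((c t - z)⁻¹ * deriv c t).im) ≤
      ∫ t in (0 : ℝ)..L, σ * (conj (c t - z) * deriv c t).im := by
    refine intervalIntegral.integral_mono_ae_restrict hL.le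
      (((hii _ hi1).const_mul _).const_mul _) ((hii _ hi2).const_mul _) ?_
    rw [Filter.EventuallyLE, ae_restrict_iff' measurableSet_Icc]
    have hae : ∀ᵐ t : ℝ, t ≠ 0 := by simp [ae_iff, measure_singleton]
    filter_upwards [hc.ae_sign_mul_im_nonneg hz hm, hae] with t ht h0 htm
    rw [conj_mul_im_eq, mul_left_comm (σ : ℝ)]
    exact mul_le_mul_of_nonneg_right (hmin htm) (ht ⟨lt_of_le_of_ne htm.1 h0.symm, htm.2⟩)
  rw [intervalIntegral.integral_const_mul, intervalIntegral.integral_const_mul,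
    intervalIntegral.integral_const_mul, ← him _ hi1, ← him _ hi2,
    hc.integral_conj_sub_mul_deriv] at hle
  refine lt_of_lt_of_le ?_ hle
  have : (∫ t in (0 : ℝ)..L, (c t - z)⁻¹ * deriv c t).im = 2 * Real.pi * σ := by
    rw [← logIncrement, hw2, hw]; simp
  rw [this]
  have hs : (σ : ℝ) * σ = 1 := by rcases hσ with rfl | rfl <;> norm_num
  rw [show (σ : ℝ) * (2 * Real.pi * σ) = 2 * Real.pi * (σ * σ) by ring, hs]
  have := Real.pi_pos
  positivity

/-- The orientation `σ` of a convex cycle: the winding number around interior points, with the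
interior on the corresponding side of the tangents. -/
theorem exists_orientation (hc : IsConvexCycle K L c) :
    ∃ σ : ℤ, (σ = 1 ∨ σ = -1) ∧ (∀ z ∈ interior K, windingNumber c 0 L z = σ) ∧
      ∀ᵐ t, t ∈ Ioc 0 L → ∀ z ∈ K, 0 ≤ σ * (conj (c t - z) * deriv c t).im := by
  obtain ⟨z₀, hz₀⟩ := hc.interior_nonempty
  obtain ⟨σ, hσ, hw, hm⟩ := hc.exists_sign_interior hz₀
  have hpos := hc.sign_mul_integral_pos hz₀ hσ hw hm
  have hall : ∀ z ∈ interior K, windingNumber c 0 L z = σ ∧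
      MonotoneOn (fun t => σ * (logIncrement c z 0 t).im) (Icc 0 L) := by
    intro z hz
    obtain ⟨τ, hτ, hw', hm'⟩ := hc.exists_sign_interior hz
    have hpos' := hc.sign_mul_integral_pos hz hτ hw' hm'
    have : τ = σ := by
      rcases hσ with rfl | rfl <;> rcases hτ with rfl | rfl <;> push_cast at hpos hpos'
      · rfl
      · linarith
      · linarith
      · rfl
    subst this
    exact ⟨hw', hm'⟩
  refine ⟨σ, hσ, fun z hz => (hall z hz).1, ?_⟩
  -- The exceptional null set depends on `z`. Countably many interior points share one, and for
  -- fixed `t` the inequality is closed in `z`, so it passes to all of `K`.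
  obtain ⟨D, hDc, hDd⟩ := TopologicalSpace.exists_countable_dense ℂ
  have hcount : (interior K ∩ D).Countable := hDc.mono inter_subset_right
  have hae : ∀ᵐ t, ∀ z ∈ interior K ∩ D, t ∈ Ioc 0 L →
      0 ≤ σ * ((c t - z)⁻¹ * deriv c t).im :=
    (ae_ball_iff hcount).2 fun z hz => hc.ae_sign_mul_im_nonneg hz.1 (hall z hz.1).2
  filter_upwards [hae] with t ht htm z hz
  have hcl : IsClosed {z : ℂ | 0 ≤ σ * (conj (c t - z) * deriv c t).im} :=
    isClosed_le continuous_const (by fun_prop)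
  have hsub : interior K ∩ D ⊆ {z : ℂ | 0 ≤ σ * (conj (c t - z) * deriv c t).im} := by
    intro w hw
    show 0 ≤ σ * (conj (c t - w) * deriv c t).im
    rw [conj_mul_im_eq, mul_left_comm]
    exact mul_nonneg (Complex.normSq_nonneg _) (ht w hw htm)
  have h1 : interior K ⊆ closure (interior K ∩ D) :=
    hDd.open_subset_closure_inter isOpen_interior
  have h2 : z ∈ closure (interior K) := by
    rw [hc.convex.closure_interior_eq_closure_of_nonempty_interior hc.interior_nonempty]
    exact subset_closure hz
  exact closure_minimal hsub hcl (closure_minimal h1 isClosed_closure h2)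

/-- The area enclosed by a convex cycle as a line integral. -/
theorem sign_mul_area {σ : ℤ} (hc : IsConvexCycle K L c)
    (hσ : ∀ z ∈ interior K, windingNumber c 0 L z = σ) :
    σ * volume.real K = (∫ t in (0 : ℝ)..L, conj (c t) * deriv c t).im / 2 := by
  rw [← (hc.lipschitzWith.integral_windingNumber hc.length_pos.le hc.apply_length).2]
  have hm : MeasurableSet K := hc.isCompact.measurableSet
  have hae : (fun z => (windingNumber c 0 L z : ℝ)) =ᵐ[volume] K.indicator fun _ => (σ : ℝ) := by
    have h0 : ∀ᵐ z, z ∉ frontier K := measure_eq_zero_iff_ae_notMem.1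
      (hc.convex.addHaar_frontier volume)
    filter_upwards [h0] with z hz
    by_cases hzK : z ∈ K
    · rw [indicator_of_mem hzK, hσ z]
      by_contra h
      exact hz ⟨subset_closure hzK, h⟩
    · rw [indicator_of_notMem hzK, hc.windingNumber_eq_zero hc.length_pos.le
        hc.lipschitzWith.continuous hc.apply_length hc.mem hzK, Int.cast_zero]
  rw [integral_congr_ae hae, integral_indicator hm, setIntegral_const, smul_eq_mul, mul_comm]

end IsConvexCycle

/-! ### Comparison of angles -/

/-- A point `(u, v)` moving with `v' = - k u`, `k ≥ 0`, crosses the `u`-axis clockwise only: its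
angle gains less than `π`. -/
theorem angle_lt_add_pi_of_ae_hasDerivAt {β R κ v : ℝ → ℝ} {a b : ℝ} (hab : a ≤ b)
    (hβ : ContinuousOn β (Icc a b)) (hR : ∀ t ∈ Icc a b, 0 < R t)
    (hvβ : ∀ t ∈ Icc a b, v t = R t * Real.sin (β t))
    (hv : AbsolutelyContinuousOnInterval v a b)
    (hd : ∀ᵐ t, t ∈ Ioc a b → 0 ≤ κ t ∧ HasDerivAt v (-(κ t * (R t * Real.cos (β t)))) t) :
    β b < β a + Real.pi := by
  have hpi := Real.pi_pos
  -- kπ is the first multiple of π not below β a; the claim is that β does not end above it.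
  set k : ℤ := ⌈β a / Real.pi⌉ with hk
  have hka : β a ≤ k * Real.pi := (div_le_iff₀ hpi).1 (Int.le_ceil _)
  have hkb : k * Real.pi < β a + Real.pi := by
    have := mul_lt_mul_of_pos_right (Int.ceil_lt_add_one (β a / Real.pi)) hpi
    rwa [add_mul, div_mul_cancel₀ _ hpi.ne', one_mul] at this
  refine lt_of_le_of_lt ?_ hkb
  by_contra! hlt
  have hne : (Icc a b ∩ β ⁻¹' Iic (k * Real.pi)).Nonempty := ⟨a, left_mem_Icc.2 hab, hka⟩
  have hcomp : IsCompact (Icc a b ∩ β ⁻¹' Iic (k * Real.pi)) :=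
    isCompact_Icc.of_isClosed_subset (hβ.preimage_isClosed_of_isClosed isClosed_Icc isClosed_Iic)
      inter_subset_left
  obtain ⟨s, ⟨hs, hsk⟩, hmax⟩ := hcomp.exists_isGreatest hne
  have hsk' : β s ≤ k * Real.pi := hsk
  have hafter : ∀ t ∈ Icc a b, s < t → k * Real.pi < β t := fun t ht hst => by
    by_contra! h
    exact absurd (hmax ⟨ht, h⟩) hst.not_ge
  have hseq : β s = k * Real.pi := by
    obtain ⟨t, ht, e⟩ := intermediate_value_Icc hs.2 (hβ.mono (Icc_subset_Icc_left hs.1))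
      ⟨hsk', hlt.le⟩
    have : t ≤ s := hmax ⟨⟨hs.1.trans ht.1, ht.2⟩, e.le⟩
    rw [le_antisymm ht.1 this, e]
  have hsb : s < b := lt_of_le_of_ne hs.2 (by rintro rfl; linarith)
  obtain ⟨δ, hδ, hclose⟩ := Metric.continuousOn_iff.1 hβ s hs (Real.pi / 2) (by positivity)
  set e := min b (s + δ / 2) with he
  have hse : s < e := lt_min hsb (by linarith)
  have heb : e ≤ b := min_le_left _ _
  have heδ : e ≤ s + δ / 2 := min_le_right _ _
  have hquad : ∀ t ∈ Ioc s e, 0 < β t - k * Real.pi ∧ β t - k * Real.pi < Real.pi / 2 := by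
    intro t ht
    have htab : t ∈ Icc a b := ⟨hs.1.trans ht.1.le, ht.2.trans heb⟩
    have h1 := hclose t htab (by
      rw [Real.dist_eq, abs_of_pos (sub_pos.2 ht.1)]; linarith [ht.2])
    rw [Real.dist_eq, hseq] at h1
    exact ⟨sub_pos.2 (hafter t htab ht.1), (abs_lt.1 h1).2⟩
  have hsin : ∀ t, Real.sin (β t - k * Real.pi) = (-1) ^ k * Real.sin (β t) := fun t =>
    Real.sin_sub_int_mul_pi _ _
  have hcos : ∀ t, Real.cos (β t - k * Real.pi) = (-1) ^ k * Real.cos (β t) := fun t =>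
    Real.cos_sub_int_mul_pi _ _
  -- Just after the last time `s` with β ≤ kπ, the quantity (-1)^k v = R sin(β - kπ) is positive,
  -- yet it starts at 0 and its derivative -κ R cos(β - kπ) is nonpositive.
  have hac : AbsolutelyContinuousOnInterval
      (fun t => (-(-1 : ℝ) ^ k) * v t) s e :=
    (hv.mono (by
      rw [uIcc_of_le hab, uIcc_of_le hse.le]
      exact Icc_subset_Icc hs.1 heb)).const_mul _
  have hle := hac.le_of_ae_deriv_nonneg hse.le (by
    filter_upwards [hd] with t ht hts
    have htab : t ∈ Ioc a b := ⟨hs.1.trans_lt hts.1, hts.2.trans heb⟩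
    obtain ⟨hκ, hder⟩ := ht htab
    rw [(hder.const_mul (-(-1 : ℝ) ^ k)).deriv]
    have hq := hquad t hts
    have h1 : 0 < Real.cos (β t - k * Real.pi) :=
      Real.cos_pos_of_mem_Ioo ⟨by linarith [hq.1], hq.2⟩
    rw [hcos] at h1
    have h2 := mul_nonneg (mul_nonneg hκ (hR t (Ioc_subset_Icc_self htab)).le) h1.le
    linarith [h2])
  have hq := hquad e (right_mem_Ioc.2 hse)
  have h1 : 0 < Real.sin (β e - k * Real.pi) :=
    Real.sin_pos_of_pos_of_lt_pi hq.1 (by linarith [hq.2])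
  have h2 : Real.sin (β s - k * Real.pi) = 0 := by rw [hseq, sub_self, Real.sin_zero]
  rw [hsin] at h1 h2
  have h3 := mul_pos (hR e ⟨hs.1.trans hse.le, heb⟩) h1
  have h4 : (-(-1 : ℝ) ^ k) * (R s * Real.sin (β s)) = 0 := by
    rw [show (-(-1 : ℝ) ^ k) * (R s * Real.sin (β s)) = -(R s * ((-1) ^ k * Real.sin (β s))) by ring,
      h2]; ring
  simp only [hvβ s hs, hvβ e ⟨hs.1.trans hse.le, heb⟩, h4] at hle
  linarith

/-- Curves whose directions (from `z` resp. `w`) are never opposite after rotation by `e` have the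
same winding number. -/
theorem IsWindingNumber.of_div_mem_slitPlane {γ η : ℝ → ℂ} {a b : ℝ} {z w e : ℂ} {n : ℤ}
    (hn : IsWindingNumber γ a b z n) (hγ : Continuous γ) (hη : Continuous η)
    (hγc : γ b = γ a) (hηc : η b = η a)
    (h : ∀ t ∈ Icc a b, (η t - w) / (e * (γ t - z)) ∈ Complex.slitPlane) :
    IsWindingNumber η a b w n := by
  obtain ⟨θ, hθ, hθ', hθn⟩ := hn
  have hne : ∀ t ∈ Icc a b, η t - w ≠ 0 ∧ e * (γ t - z) ≠ 0 := fun t ht => by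
    have := Complex.slitPlane_ne_zero (h t ht)
    exact div_ne_zero_iff.1 this
  -- The principal argument of the quotient is continuous on the slit plane and returns to its
  -- initial value, so the total increment is that of `θ`.
  refine ⟨fun t => ((η t - w) / (e * (γ t - z))).arg + e.arg + θ t, ?_, fun t ht =>
    ⟨sub_ne_zero.1 (hne t ht).1, ?_⟩, ?_⟩
  · refine (ContinuousOn.add (fun t ht => ?_) continuousOn_const).add hθ
    have h1 : ContinuousAt (fun t => (η t - w) / (e * (γ t - z))) t :=
      ContinuousAt.div (by fun_prop) (by fun_prop) (hne t ht).2
    exact (ContinuousAt.comp (f := fun t => (η t - w) / (e * (γ t - z)))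
      (Complex.continuousAt_arg (h t ht)) h1).continuousWithinAt
  · obtain ⟨h1, h2⟩ := hne t ht
    have hγ' := (hθ' t ht).2
    have ha := Complex.norm_mul_exp_arg_mul_I ((η t - w) / (e * (γ t - z)))
    have hb := Complex.norm_mul_exp_arg_mul_I e
    push_cast
    rw [add_mul, add_mul, Complex.exp_add, Complex.exp_add]
    rw [norm_div, norm_mul] at ha
    have e0 : e ≠ 0 := left_ne_zero_of_mul h2
    have g0 : γ t - z ≠ 0 := right_ne_zero_of_mul h2
    have n0 : (‖e‖ : ℂ) ≠ 0 := by exact_mod_cast norm_ne_zero_iff.2 e0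
    have n1 : (‖γ t - z‖ : ℂ) ≠ 0 := by exact_mod_cast norm_ne_zero_iff.2 g0
    push_cast at ha
    generalize Complex.exp (((η t - w) / (e * (γ t - z))).arg * Complex.I) = E₁ at ha ⊢
    generalize Complex.exp (e.arg * Complex.I) = E₂ at hb ⊢
    generalize Complex.exp (θ t * Complex.I) = E₃ at hγ' ⊢
    rw [eq_div_iff h2] at ha
    refine ha.symm.trans ?_
    calc (‖η t - w‖ / (‖e‖ * ‖γ t - z‖) * E₁ * (e * (γ t - z)) : ℂ)
        = ‖η t - w‖ / (‖e‖ * ‖γ t - z‖) * E₁ * ((‖e‖ * E₂) * (‖γ t - z‖ * E₃)) := by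
          rw [hb, ← hγ']
      _ = ‖η t - w‖ * (E₁ * E₂ * E₃) := by field_simp
  · simp only [hγc, hηc]
    linarith

/-! ### Halving chords and the midpoint curve -/

/-- Half of the halving chord that starts at `c t`. -/
noncomputable def halfChord (L : ℝ) (c : ℝ → ℂ) (t : ℝ) : ℂ :=
  (c (t + L / 2) - c t) / 2

theorem midpointCurve_sub_halfChord (L : ℝ) (c : ℝ → ℂ) (t : ℝ) :
    midpointCurve L c t - halfChord L c t = c t := by
  rw [midpointCurve, halfChord]; ring

theorem midpointCurve_add_halfChord (L : ℝ) (c : ℝ → ℂ) (t : ℝ) :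
    midpointCurve L c t + halfChord L c t = c (t + L / 2) := by
  rw [midpointCurve, halfChord]; ring

/-- The pointwise relations between the unit tangents `u`, `v` at the endpoints of a chord in
direction `D`. -/
theorem tangent_relations {σ : ℤ} {D u v : ℂ} (hu : ‖u‖ = 1) (hv : ‖v‖ = 1)
    (hre : (conj D * (v - u)).re = 0) (hσ : σ = 1 ∨ σ = -1)
    (h1 : 0 ≤ σ * (conj (-D) * u).im) (h2 : 0 ≤ σ * (conj D * v).im) :
    (conj D * (v + u)).im = 0 ∧ 0 ≤ σ * (conj D * (v - u)).im := by
  have e : Complex.normSq (conj D * u) = Complex.normSq (conj D * v) := by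
    rw [Complex.normSq_mul, Complex.normSq_mul, Complex.normSq_eq_norm_sq u,
      Complex.normSq_eq_norm_sq v, hu, hv]
  rw [Complex.normSq_apply, Complex.normSq_apply] at e
  rw [mul_sub, Complex.sub_re] at hre
  rw [map_neg, neg_mul, Complex.neg_im] at h1
  rw [mul_add, mul_sub, Complex.add_im, Complex.sub_im]
  generalize (conj D * u).im = p at *
  generalize (conj D * v).im = q at *
  have hr : (conj D * v).re = (conj D * u).re := by linarith
  rw [hr] at e
  -- Equal moduli and equal real parts give q = ±p. Since σp ≤ 0 ≤ σq, the case q = p forces both to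
  -- vanish.
  have hpq : (q - p) * (q + p) = 0 := by linarith
  refine ⟨?_, by rw [mul_sub]; linarith⟩
  rcases mul_eq_zero.1 hpq with h | h
  · rcases hσ with rfl | rfl <;> push_cast at h1 h2 <;> linarith
  · exact h

namespace IsConvexCycle

variable {K : Set ℂ} {L h : ℝ} {c : ℝ → ℂ}

theorem halfLength_pos (hc : IsConvexCycle K L c) : 0 < L / 2 := half_pos hc.length_pos

theorem apply_add_half_add_half (hc : IsConvexCycle K L c) (t : ℝ) :
    c (t + L / 2 + L / 2) = c t := by
  rw [add_assoc, add_halves]; exact hc.periodic t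

theorem halfChord_add_half (hc : IsConvexCycle K L c) (t : ℝ) :
    halfChord L c (t + L / 2) = -halfChord L c t := by
  rw [halfChord, halfChord, hc.apply_add_half_add_half]; ring

theorem midpointCurve_add_half (hc : IsConvexCycle K L c) (t : ℝ) :
    midpointCurve L c (t + L / 2) = midpointCurve L c t := by
  rw [midpointCurve, midpointCurve, hc.apply_add_half_add_half]; ring

theorem midpointCurve_half (hc : IsConvexCycle K L c) :
    midpointCurve L c (L / 2) = midpointCurve L c 0 := by
  simpa using hc.midpointCurve_add_half 0

theorem lipschitzWith_shift (hc : IsConvexCycle K L c) :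
    LipschitzWith 1 fun t => c (t + L / 2) := fun x y => by
  simpa using hc.lipschitzWith (x + L / 2) (y + L / 2)

theorem lipschitzWith_halfChord (hc : IsConvexCycle K L c) : LipschitzWith 1 (halfChord L c) := by
  refine LipschitzWith.of_dist_le_mul fun x y => ?_
  have h1 := hc.lipschitzWith_shift.dist_le_mul x y
  have h2 := hc.lipschitzWith.dist_le_mul x y
  rw [dist_eq_norm] at h1 h2 ⊢
  rw [halfChord, halfChord, show (c (x + L / 2) - c x) / 2 - (c (y + L / 2) - c y) / 2 =
    ((c (x + L / 2) - c (y + L / 2)) - (c x - c y)) / 2 by ring, norm_div]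
  have := norm_sub_le (c (x + L / 2) - c (y + L / 2)) (c x - c y)
  simp only [Complex.norm_ofNat]
  linarith

theorem lipschitzWith_midpointCurve (hc : IsConvexCycle K L c) :
    LipschitzWith 1 (midpointCurve L c) := by
  refine LipschitzWith.of_dist_le_mul fun x y => ?_
  have h1 := hc.lipschitzWith_shift.dist_le_mul x y
  have h2 := hc.lipschitzWith.dist_le_mul x y
  rw [dist_eq_norm] at h1 h2 ⊢
  rw [midpointCurve, midpointCurve, show (c x + c (x + L / 2)) / 2 - (c y + c (y + L / 2)) / 2 =
    ((c (x + L / 2) - c (y + L / 2)) + (c x - c y)) / 2 by ring, norm_div]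
  have := norm_add_le (c (x + L / 2) - c (y + L / 2)) (c x - c y)
  simp only [Complex.norm_ofNat]
  linarith

theorem norm_halfChord (hh : HasConstantHalvingDistance L c h) (t : ℝ) :
    ‖halfChord L c t‖ = h / 2 := by
  have := hh t
  rw [dist_comm, dist_eq_norm] at this
  rw [halfChord, norm_div, this]; simp

theorem halvingDistance_pos (hc : IsConvexCycle K L c) (hh : HasConstantHalvingDistance L c h) :
    0 < h := by
  rw [← hh 0, zero_add, dist_pos]
  intro e
  have hL := hc.length_pos
  have := hc.injOn ⟨le_rfl, hL⟩ ⟨hc.halfLength_pos.le, half_lt_self hL⟩ e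
  linarith

theorem halfChord_ne_zero (hc : IsConvexCycle K L c) (hh : HasConstantHalvingDistance L c h)
    (t : ℝ) : halfChord L c t ≠ 0 := by
  rw [← norm_ne_zero_iff, norm_halfChord hh]
  have := hc.halvingDistance_pos hh
  positivity

/-- The halving chord makes one full turn, like the curve itself. -/
theorem windingNumber_halfChord {σ : ℤ} (hc : IsConvexCycle K L c)
    (hh : HasConstantHalvingDistance L c h)
    (hσ : ∀ z ∈ interior K, windingNumber c 0 L z = σ) :
    windingNumber (halfChord L c) 0 L 0 = σ := by
  obtain ⟨z, hz⟩ := hc.interior_nonempty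
  have hL := hc.length_pos.le
  have hw := isWindingNumber_windingNumber hL hc.lipschitzWith hc.apply_length
    (fun t _ => hc.ne_of_mem_interior hz t)
  rw [hσ z hz] at hw
  refine (hw.of_div_mem_slitPlane (e := -1) hc.lipschitzWith.continuous
    hc.lipschitzWith_halfChord.continuous hc.apply_length ?_ fun t _ => ?_).eq_windingNumber hL
  · have h1 := hc.halfChord_add_half (L / 2)
    have h2 := hc.halfChord_add_half 0
    rw [add_halves] at h1
    rw [zero_add] at h2
    rw [h1, h2, neg_neg]
  · have hne := hc.ne_of_mem_interior hz t
    have h0 := hc.halfChord_ne_zero hh t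
    have hcz : c t - z ≠ 0 := sub_ne_zero.2 hne
    rw [sub_zero]
    by_contra hslit
    rw [Complex.mem_slitPlane_iff_not_le_zero, not_not, Complex.le_def] at hslit
    obtain ⟨hre, him⟩ := hslit
    set ρ := halfChord L c t / (-1 * (c t - z)) with hρ
    have hρ' : ρ = (ρ.re : ℂ) := Complex.ext rfl (by simpa using him)
    have e1 : halfChord L c t = -(ρ.re : ℂ) * (c t - z) := by
      rw [← hρ', hρ]; field_simp
    -- A ratio ρ ≤ 0 would put both chord ends on one ray from `z`, hence make them equal.
    have e2 : c (t + L / 2) - z = ((1 - 2 * ρ.re : ℝ) : ℂ) * (c t - z) := by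
      rw [halfChord] at e1
      push_cast
      linear_combination 2 * e1
    have e3 := hc.eq_of_sub_eq_smul hz (hc.mem_frontier _) (hc.mem_frontier t)
      (by simp at hre; linarith) e2
    exact h0 (by rw [halfChord, e3, sub_self, zero_div])

/-- Over half a period the halving chord makes half a turn. -/
theorem logIncrement_halfChord {σ : ℤ} (hc : IsConvexCycle K L c)
    (hh : HasConstantHalvingDistance L c h)
    (hσ : ∀ z ∈ interior K, windingNumber c 0 L z = σ) :
    logIncrement (halfChord L c) 0 0 (L / 2) = Real.pi * σ * Complex.I := by
  have hL := hc.length_pos.le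
  have hne : ∀ a b : ℝ, ∀ t ∈ Icc a b, halfChord L c t ≠ 0 := fun _ _ t _ =>
    hc.halfChord_ne_zero hh t
  have hcl : halfChord L c L = halfChord L c 0 := by
    have h1 := hc.halfChord_add_half (L / 2)
    have h2 := hc.halfChord_add_half 0
    rw [add_halves] at h1
    rw [zero_add] at h2
    rw [h1, h2, neg_neg]
  have hw := logIncrement_eq_windingNumber hL hc.lipschitzWith_halfChord hcl (hne 0 L)
  rw [hc.windingNumber_halfChord hh hσ] at hw
  -- Since d(t + L/2) = -d(t), the integrand d'/d has period L/2, and each half period carries half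
  -- of 2πσi.
  have hper : Function.Periodic
      (fun s => (halfChord L c s - 0)⁻¹ * deriv (halfChord L c) s) (L / 2) := fun s => by
    have hd : deriv (halfChord L c) (s + L / 2) = -deriv (halfChord L c) s := by
      rw [← deriv_comp_add_const, ← deriv.fun_neg]
      congr 1
      ext t
      exact hc.halfChord_add_half t
    simp only [hd, hc.halfChord_add_half s, sub_zero, inv_neg, neg_mul_neg]
  have hshift := hper.intervalIntegral_add_eq 0 (L / 2)
  rw [zero_add, add_halves] at hshift
  have hsplit := intervalIntegral.integral_add_adjacent_intervals
    (intervalIntegrable_logIncrement hc.halfLength_pos.le hc.lipschitzWith_halfChord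
      (hne 0 (L / 2)))
    (intervalIntegrable_logIncrement (half_le_self hL) hc.lipschitzWith_halfChord
      (hne (L / 2) L))
  rw [← hshift] at hsplit
  simp only [logIncrement] at hw ⊢
  rw [hw] at hsplit
  linear_combination hsplit / 2

theorem ae_hasDerivAt_shift (hc : IsConvexCycle K L c) :
    ∀ᵐ t, HasDerivAt (fun t => c (t + L / 2)) (deriv c (t + L / 2)) t := by
  filter_upwards [hc.lipschitzWith_shift.ae_hasDerivAt_deriv] with t ht
  rwa [deriv_comp_add_const] at ht

theorem ae_hasDerivAt_halfChord (hc : IsConvexCycle K L c) :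
    ∀ᵐ t, HasDerivAt (halfChord L c) ((deriv c (t + L / 2) - deriv c t) / 2) t := by
  filter_upwards [hc.lipschitzWith.ae_hasDerivAt_deriv, hc.ae_hasDerivAt_shift] with t h1 h2
  exact (h2.sub h1).div_const 2

theorem ae_hasDerivAt_midpointCurve (hc : IsConvexCycle K L c) :
    ∀ᵐ t, HasDerivAt (midpointCurve L c) ((deriv c (t + L / 2) + deriv c t) / 2) t := by
  filter_upwards [hc.lipschitzWith.ae_hasDerivAt_deriv, hc.ae_hasDerivAt_shift] with t h1 h2
  rw [add_comm (deriv c (t + L / 2))]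
  exact (h1.add h2).div_const 2

theorem re_conj_halfChord_mul_deriv (hh : HasConstantHalvingDistance L c h) {t : ℝ} {d' : ℂ}
    (hd : HasDerivAt (halfChord L c) d' t) : (conj (halfChord L c t) * d').re = 0 := by
  have hconst : (fun t => ‖halfChord L c t‖ ^ 2) = fun _ => (h / 2) ^ 2 :=
    funext fun t => by rw [norm_halfChord hh]
  have h1 := hd.norm_sq
  rw [hconst] at h1
  have h2 := h1.unique (hasDerivAt_const t _)
  rw [Complex.inner, mul_comm d'] at h2
  linarith

/-- The midpoint moves along the halving chord, which turns in the sense of the orientation. -/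
theorem ae_deriv_relations {σ : ℤ} (hc : IsConvexCycle K L c)
    (hh : HasConstantHalvingDistance L c h) (hσ : σ = 1 ∨ σ = -1)
    (hside : ∀ᵐ t, t ∈ Ioc 0 L → ∀ z ∈ K, 0 ≤ σ * (conj (c t - z) * deriv c t).im) :
    ∀ᵐ t, t ∈ Ioc 0 (L / 2) →
      (conj (halfChord L c t) * deriv (midpointCurve L c) t).im = 0 ∧
      (conj (halfChord L c t) * deriv (halfChord L c) t).re = 0 ∧
      0 ≤ σ * (conj (halfChord L c t) * deriv (halfChord L c) t).im := by
  have hunit := hc.unitSpeed.ae_norm_deriv_eq_one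
  have hqmp := (measurePreserving_add_right (volume : Measure ℝ) (L / 2)).quasiMeasurePreserving
  filter_upwards [hunit, hqmp.ae hunit, hside, hqmp.ae hside, hc.ae_hasDerivAt_halfChord,
    hc.ae_hasDerivAt_midpointCurve] with t u1 u2 s1 s2 hd hm ht
  have hL := hc.length_pos
  have hre := re_conj_halfChord_mul_deriv hh hd
  have t1 := s1 ⟨ht.1, by linarith [ht.2]⟩ _ (hc.mem (t + L / 2))
  have t2 := s2 ⟨by linarith [ht.1], by linarith [ht.2]⟩ _ (hc.mem t)
  rw [hd.deriv, hm.deriv]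
  have hD1 : c t - c (t + L / 2) = ((2 : ℝ) : ℂ) * -halfChord L c t := by
    rw [halfChord]; push_cast; ring
  have hD2 : c (t + L / 2) - c t = ((2 : ℝ) : ℂ) * halfChord L c t := by
    rw [halfChord]; push_cast; ring
  rw [hD1, map_mul, Complex.conj_ofReal, mul_assoc, Complex.im_ofReal_mul] at t1
  rw [hD2, map_mul, Complex.conj_ofReal, mul_assoc, Complex.im_ofReal_mul] at t2
  have half : ∀ w : ℂ, conj (halfChord L c t) * (w / 2) =
      ((1 / 2 : ℝ) : ℂ) * (conj (halfChord L c t) * w) := fun w => by push_cast; ring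
  rw [half, Complex.re_ofReal_mul] at hre
  obtain ⟨r1, r2⟩ := tangent_relations u1 u2
    ((mul_eq_zero.1 hre).resolve_left (by norm_num)) hσ (by linarith) (by linarith)
  rw [half, half, Complex.im_ofReal_mul, Complex.im_ofReal_mul, Complex.re_ofReal_mul, r1]
  exact ⟨by ring, hre, by linarith⟩

theorem _root_.Complex.lipschitz_im : LipschitzWith 1 Complex.im :=
  LipschitzWith.of_dist_le_mul fun z w => by
    rw [NNReal.coe_one, one_mul, Real.dist_eq, dist_eq_norm, ← Complex.sub_im]
    exact Complex.abs_im_le_norm _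

theorem _root_.Complex.lipschitz_re : LipschitzWith 1 Complex.re :=
  LipschitzWith.of_dist_le_mul fun z w => by
    rw [NNReal.coe_one, one_mul, Real.dist_eq, dist_eq_norm, ← Complex.sub_re]
    exact Complex.abs_re_le_norm _

theorem _root_.LipschitzWith.absolutelyContinuousOnInterval_im_mul_conj {γ η : ℝ → ℂ} {C D : ℝ≥0}
    (hγ : LipschitzWith C γ) (hη : LipschitzWith D η) (a b : ℝ) :
    AbsolutelyContinuousOnInterval (fun t => (γ t * conj (η t)).im) a b := by
  have hac : ∀ {f : ℝ → ℝ} {N : ℝ≥0}, LipschitzWith N f → AbsolutelyContinuousOnInterval f a b :=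
    fun hf => hf.lipschitzOnWith.absolutelyContinuousOnInterval
  have h1 := ((hac (Complex.lipschitz_im.comp hγ)).fun_mul
    (hac (Complex.lipschitz_re.comp hη))).sub
    ((hac (Complex.lipschitz_re.comp hγ)).fun_mul (hac (Complex.lipschitz_im.comp hη)))
  have e : (fun t => (γ t * conj (η t)).im) = (fun t => (γ t).im * (η t).re) -
      fun t => (γ t).re * (η t).im := by
    ext t
    simp only [Complex.mul_im, Complex.conj_re, Complex.conj_im, Pi.sub_apply]
    ring
  rw [e]
  exact h1

/-! ### Sign of the winding number of the midpoint curve -/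

/-- The midpoint curve winds around every point against the orientation of the cycle. -/
theorem sign_mul_windingNumber_midpointCurve_nonpos {σ : ℤ} (hc : IsConvexCycle K L c)
    (hh : HasConstantHalvingDistance L c h) (hσ : σ = 1 ∨ σ = -1)
    (hwc : ∀ z ∈ interior K, windingNumber c 0 L z = σ)
    (hside : ∀ᵐ t, t ∈ Ioc 0 L → ∀ z ∈ K, 0 ≤ σ * (conj (c t - z) * deriv c t).im) (z : ℂ) :
    σ * windingNumber (midpointCurve L c) 0 (L / 2) z ≤ 0 := by
  by_cases hz : ∃ t ∈ Icc 0 (L / 2), midpointCurve L c t = z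
  · rw [windingNumber_of_mem hz, mul_zero]
  have hne : ∀ t ∈ Icc 0 (L / 2), midpointCurve L c t ≠ z := fun t ht e => hz ⟨t, ht, e⟩
  have hl := hc.halfLength_pos.le
  have hh0 := hc.halvingDistance_pos hh
  have hd0 : ∀ t ∈ Icc 0 (L / 2), halfChord L c t ≠ 0 := fun t _ => hc.halfChord_ne_zero hh t
  have hmL := hc.lipschitzWith_midpointCurve
  have hdL := hc.lipschitzWith_halfChord
  set m := midpointCurve L c with hm
  set d := halfChord L c with hd
  -- The angle of m - z relative to the chord; (m - z) conj d is m - z in the chord's frame, scaled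
  -- by h/2.
  set φ : ℝ → ℝ := fun t => ((m 0 - z).arg + (logIncrement m z 0 t).im) -
    ((d 0 - 0).arg + (logIncrement d 0 0 t).im) with hφ
  have hφc : ContinuousOn φ (Icc 0 (L / 2)) :=
    (continuousOn_const.add (Complex.continuous_im.comp_continuousOn
      (continuousOn_logIncrement hl hmL hne))).sub
    (continuousOn_const.add (Complex.continuous_im.comp_continuousOn
      (continuousOn_logIncrement hl hdL hd0)))
  set R : ℝ → ℝ := fun t => ‖m t - z‖ * (h / 2) with hRdef
  have hpolar : ∀ t ∈ Icc 0 (L / 2), (m t - z) * conj (d t) =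
      (R t : ℂ) * Complex.exp (φ t * Complex.I) := by
    intro t ht
    have e1 := sub_eq_norm_mul_exp hl hmL hne ht
    have e2 := sub_eq_norm_mul_exp hl hdL hd0 ht
    have e3 := congrArg conj e2
    rw [map_mul, Complex.conj_ofReal, ← Complex.exp_conj, map_mul, Complex.conj_I,
      Complex.conj_ofReal, sub_zero, norm_halfChord hh] at e3
    have e4 : (φ t : ℂ) * Complex.I =
        (((m 0 - z).arg + (logIncrement m z 0 t).im : ℝ) : ℂ) * Complex.I +
        (((d 0 - 0).arg + (logIncrement d 0 0 t).im : ℝ) : ℂ) * -Complex.I := by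
      rw [hφ]; push_cast; ring
    rw [e4, Complex.exp_add, hRdef]
    generalize Complex.exp
      ((((m 0 - z).arg + (logIncrement m z 0 t).im : ℝ) : ℂ) * Complex.I) = E₁ at *
    rw [e3]
    nth_rw 1 [e1]
    push_cast
    ring
  have hσσ : (σ : ℝ) * σ = 1 := by rcases hσ with rfl | rfl <;> norm_num
  have hre : ∀ t ∈ Icc 0 (L / 2), ((m t - z) * conj (d t)).re = R t * Real.cos (σ * φ t) := by
    intro t ht
    rw [hpolar t ht, Complex.re_ofReal_mul, Complex.exp_ofReal_mul_I_re]
    rcases hσ with rfl | rfl <;> simp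
  have him : ∀ t ∈ Icc 0 (L / 2),
      σ * ((m t - z) * conj (d t)).im = R t * Real.sin (σ * φ t) := by
    intro t ht
    rw [hpolar t ht, Complex.im_ofReal_mul, Complex.exp_ofReal_mul_I_im]
    rcases hσ with rfl | rfl <;> simp
  have hsub : LipschitzWith 1 fun t => m t - z := fun x y => by simpa using hmL x y
  -- Here κ is σ times the angular speed of the chord. In the derivative of (m - z) conj d the term
  -- m' conj d is real, and conj d' is -i times the angular speed times conj d.
  have key := angle_lt_add_pi_of_ae_hasDerivAt (β := fun t => σ * φ t) (R := R)
    (κ := fun t => σ * (conj (d t) * deriv d t).im / (h / 2) ^ 2)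
    (v := fun t => σ * ((m t - z) * conj (d t)).im) hl
    (continuousOn_const.mul hφc)
    (fun t ht => mul_pos (norm_pos_iff.2 (sub_ne_zero.2 (hne t ht))) (half_pos hh0)) him
    ((hsub.absolutelyContinuousOnInterval_im_mul_conj hdL 0 (L / 2)).const_mul _) (by
      filter_upwards [hc.ae_deriv_relations hh hσ hside, hmL.ae_hasDerivAt_deriv,
        hdL.ae_hasDerivAt_deriv] with t hrel h1 h2 ht
      obtain ⟨r1, r2, r3⟩ := hrel ht
      refine ⟨by positivity, ?_⟩
      have h3 : HasDerivAt (fun t => σ * ((m t - z) * conj (d t)).im)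
          (σ * (deriv m t * conj (d t) + (m t - z) * conj (deriv d t)).im) t :=
        (Complex.imCLM.hasFDerivAt.comp_hasDerivAt t ((h1.sub_const z).mul
          (Complex.conjCLE.hasFDerivAt.comp_hasDerivAt t h2))).const_mul _
      refine h3.congr_deriv ?_
      rw [← hre t (Ioc_subset_Icc_self ht), Complex.add_im, mul_comm (deriv m t), r1, zero_add]
      have hnorm : conj (d t) * d t = (((h / 2) ^ 2 : ℝ) : ℂ) := by
        rw [Complex.conj_mul', norm_halfChord hh]; push_cast; ring
      have hκ : d t * conj (deriv d t) = -((conj (d t) * deriv d t).im : ℂ) * Complex.I := by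
        have e := congrArg conj (Complex.re_add_im (conj (d t) * deriv d t))
        rw [r2] at e
        simp only [map_add, map_mul, Complex.conj_ofReal, Complex.conj_I, Complex.conj_conj] at e
        rw [← e]; push_cast; ring
      have hprod : (((h / 2) ^ 2 : ℝ) : ℂ) * ((m t - z) * conj (deriv d t)) =
          ((-(conj (d t) * deriv d t).im : ℝ) : ℂ) * (((m t - z) * conj (d t)) * Complex.I) := by
        rw [← hnorm]
        push_cast
        linear_combination (m t - z) * conj (d t) * hκ
      have hprod' := congrArg Complex.im hprod
      rw [Complex.im_ofReal_mul, Complex.im_ofReal_mul, Complex.mul_I_im] at hprod'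
      have hpos : (h / 2) ^ 2 ≠ 0 := by positivity
      field_simp
      linear_combination 4 * σ * hprod')
  have hwm := logIncrement_eq_windingNumber hl hmL hc.midpointCurve_half hne
  have hwd := hc.logIncrement_halfChord hh hwc
  rw [← hd] at hwd
  have z1 : logIncrement m z 0 0 = 0 := intervalIntegral.integral_same
  have z2 : logIncrement d 0 0 0 = 0 := intervalIntegral.integral_same
  simp only [hφ, hwm, hwd, z1, z2] at key
  simp at key
  set w := windingNumber m 0 (L / 2) z with hw
  -- The relative angle gains 2πw - πσ, so multiplication by σ gives 2πσw - π < π.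
  have hlt : (σ * w : ℝ) * (2 * Real.pi) < 1 * (2 * Real.pi) := by
    linear_combination key + Real.pi * hσσ
  have hlt' := lt_of_mul_lt_mul_right hlt (by positivity)
  have : σ * w < 1 := by exact_mod_cast hlt'
  omega

/-! ### The area formula -/

theorem integrable_midpointMultiplicity (hc : IsConvexCycle K L c) :
    Integrable (midpointMultiplicity L c) :=
  (hc.lipschitzWith_midpointCurve.integral_windingNumber hc.halfLength_pos.le
    hc.midpointCurve_half).1.abs

/-- The line integral of a convex cycle splits into the contributions of the midpoint curve and of
the halving chords. -/
theorem integral_conj_mul_deriv_eq (hc : IsConvexCycle K L c) :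
    ∫ t in (0 : ℝ)..L, conj (c t) * deriv c t =
      2 * ((∫ t in (0 : ℝ)..(L / 2), conj (midpointCurve L c t) * deriv (midpointCurve L c) t) +
        ∫ t in (0 : ℝ)..(L / 2), conj (halfChord L c t) * deriv (halfChord L c) t) := by
  have hi : ∀ {γ : ℝ → ℂ}, LipschitzWith 1 γ → ∀ a b : ℝ,
      IntervalIntegrable (fun t => conj (γ t) * deriv γ t) volume a b := fun hγ a b =>
    hγ.intervalIntegrable_mul_deriv (Complex.continuous_conj.comp hγ.continuous).continuousOn
  have hs : ∫ t in (L / 2)..L, conj (c t) * deriv c t =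
      ∫ t in (0 : ℝ)..(L / 2), conj (c (t + L / 2)) * deriv c (t + L / 2) := by
    rw [intervalIntegral.integral_comp_add_right (fun t => conj (c t) * deriv c t), zero_add,
      add_halves]
  have hi2 : IntervalIntegrable (fun t => conj (c (t + L / 2)) * deriv c (t + L / 2))
      volume 0 (L / 2) := by
    simpa only [deriv_comp_add_const] using hi hc.lipschitzWith_shift 0 (L / 2)
  rw [← intervalIntegral.integral_add_adjacent_intervals (hi hc.lipschitzWith 0 (L / 2))
    (hi hc.lipschitzWith (L / 2) L), hs, ← intervalIntegral.integral_add
    (hi hc.lipschitzWith 0 (L / 2)) hi2, ← intervalIntegral.integral_add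
    (hi hc.lipschitzWith_midpointCurve 0 (L / 2)) (hi hc.lipschitzWith_halfChord 0 (L / 2)),
    ← intervalIntegral.integral_const_mul]
  refine intervalIntegral.integral_congr_ae ?_
  filter_upwards [hc.ae_hasDerivAt_halfChord, hc.ae_hasDerivAt_midpointCurve] with t hd hm _
  have e1 : conj (c (t + L / 2)) = conj (midpointCurve L c t) + conj (halfChord L c t) := by
    rw [← map_add, midpointCurve_add_halfChord]
  have e2 : conj (c t) = conj (midpointCurve L c t) - conj (halfChord L c t) := by
    rw [← map_sub, midpointCurve_sub_halfChord]
  rw [hd.deriv, hm.deriv, e1, e2]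
  ring

/-- Constant modulus gives conj d · d' = (h/2)² d'/d, so the areal integral is (h/2)² times the half
turn. -/
theorem im_integral_conj_halfChord {σ : ℤ} (hc : IsConvexCycle K L c)
    (hh : HasConstantHalvingDistance L c h)
    (hwc : ∀ z ∈ interior K, windingNumber c 0 L z = σ) :
    (∫ t in (0 : ℝ)..(L / 2), conj (halfChord L c t) * deriv (halfChord L c) t).im =
      (h / 2) ^ 2 * (Real.pi * σ) := by
  have e : ∀ t, conj (halfChord L c t) * deriv (halfChord L c) t =
      (((h / 2) ^ 2 : ℝ) : ℂ) * ((halfChord L c t - 0)⁻¹ * deriv (halfChord L c) t) := fun t => by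
    have h0 := hc.halfChord_ne_zero hh t
    have hnorm : conj (halfChord L c t) * halfChord L c t = (((h / 2) ^ 2 : ℝ) : ℂ) := by
      rw [Complex.conj_mul', norm_halfChord hh]; push_cast; ring
    rw [← hnorm, sub_zero]; field_simp
  simp only [e]
  rw [intervalIntegral.integral_const_mul, ← logIncrement, hc.logIncrement_halfChord hh hwc,
    Complex.im_ofReal_mul]
  simp

theorem area_eq (hc : IsConvexCycle K L c) (hh : HasConstantHalvingDistance L c h) :
    volume.real K = Real.pi / 4 * h ^ 2 - 2 * midpointArea L c := by
  obtain ⟨σ, hσ, hwc, hside⟩ := hc.exists_orientation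
  have hσσ : (σ : ℝ) * σ = 1 := by rcases hσ with rfl | rfl <;> norm_num
  have harea := hc.sign_mul_area hwc
  have hgreen := (hc.lipschitzWith_midpointCurve.integral_windingNumber hc.halfLength_pos.le
    hc.midpointCurve_half).2
  -- As σw ≤ 0 everywhere, |w| = -σw, and the absolute value leaves the integral as a constant
  -- factor.
  have hM : midpointArea L c =
      -σ * ∫ z, (windingNumber (midpointCurve L c) 0 (L / 2) z : ℝ) := by
    rw [midpointArea, ← integral_const_mul]
    congr 1
    ext z
    have hz := hc.sign_mul_windingNumber_midpointCurve_nonpos hh hσ hwc hside z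
    rw [midpointMultiplicity]
    have hz' : (σ : ℝ) * windingNumber (midpointCurve L c) 0 (L / 2) z ≤ 0 := by exact_mod_cast hz
    have habs : |(σ : ℝ)| = 1 := by rcases hσ with rfl | rfl <;> simp
    rw [← one_mul |(windingNumber (midpointCurve L c) 0 (L / 2) z : ℝ)|, ← habs, ← abs_mul,
      abs_of_nonpos hz']
    ring
  rw [hc.integral_conj_mul_deriv_eq, show (2 : ℂ) = ((2 : ℝ) : ℂ) by norm_num,
    Complex.im_ofReal_mul, Complex.add_im, hc.im_integral_conj_halfChord hh hwc] at harea
  rw [hM, hgreen]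
  linear_combination (σ : ℝ) * harea - (volume.real K - (h / 2) ^ 2 * Real.pi) * hσσ

theorem area_le (hc : IsConvexCycle K L c) (hh : HasConstantHalvingDistance L c h) :
    volume.real K ≤ Real.pi / 4 * h ^ 2 := by
  have h0 : 0 ≤ midpointArea L c := integral_nonneg fun z => abs_nonneg _
  rw [hc.area_eq hh]
  linarith

end IsConvexCycle

/-! ### The circle as extremal example -/

/-- The circle of diameter `h` around `x`, parameterized by arc length. -/
noncomputable def circleCycle (x : ℂ) (h t : ℝ) : ℂ :=
  x + (h / 2 : ℝ) * Complex.exp (Complex.I * (2 * t / h : ℝ))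

theorem norm_circleCycle_sub {x : ℂ} {h : ℝ} (hh : 0 < h) (s t : ℝ) :
    ‖circleCycle x h s - circleCycle x h t‖ = h * |Real.sin ((s - t) / h)| := by
  have e : circleCycle x h s - circleCycle x h t =
      (h / 2 : ℝ) * (Complex.exp (Complex.I * (2 * t / h : ℝ)) *
        (Complex.exp (Complex.I * (2 * (s - t) / h : ℝ)) - 1)) := by
    rw [mul_sub, mul_one, ← Complex.exp_add, ← mul_add, ← Complex.ofReal_add, ← add_div,
      ← mul_add, add_sub_cancel, circleCycle, circleCycle]
    ring
  rw [e, norm_mul, norm_mul, Complex.norm_exp_I_mul_ofReal_sub_one, mul_comm Complex.I,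
    Complex.norm_exp_ofReal_mul_I, Complex.norm_real, Real.norm_of_nonneg (by positivity),
    one_mul, norm_mul, Real.norm_eq_abs, Real.norm_eq_abs, abs_two,
    show 2 * (s - t) / h / 2 = (s - t) / h by ring]
  ring

theorem lipschitzWith_circleCycle (x : ℂ) {h : ℝ} (hh : 0 < h) :
    LipschitzWith 1 (circleCycle x h) := by
  refine LipschitzWith.of_dist_le_mul fun s t => ?_
  rw [dist_eq_norm, norm_circleCycle_sub hh, Real.dist_eq, NNReal.coe_one, one_mul]
  calc h * |Real.sin ((s - t) / h)| ≤ h * |(s - t) / h| :=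
        mul_le_mul_of_nonneg_left Real.abs_sin_le_abs hh.le
    _ = |s - t| := by rw [abs_div, abs_of_pos hh]; field_simp

/-- The Lipschitz bound limits the length from above. Inscribed polygons with `n` equal steps limit
it from below, and their lengths n h sin(δ/n) tend to hδ. -/
theorem hasUnitSpeedOn_circleCycle (x : ℂ) {h : ℝ} (hh : 0 < h) :
    HasUnitSpeedOn (circleCycle x h) univ := by
  rw [HasUnitSpeedOn, hasConstantSpeedOnWith_iff_ordered]
  intro a _ b _ hab
  rw [univ_inter, NNReal.coe_one, one_mul]
  apply le_antisymm
  · have h1 := ((lipschitzWith_circleCycle x hh).lipschitzOnWith (s := univ)).comp_eVariationOn_le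
      (g := id) (mapsTo_univ id (Icc a b))
    rwa [Function.comp_id, eVariationOn_id_Icc, ENNReal.coe_one, one_mul] at h1
  · set δ := (b - a) / h with hδ
    -- Writing the polygon length with `sinc` reduces the limit to continuity at 0 and covers a = b
    -- as well.
    have hsum : ∀ n : ℕ, 0 < n → ENNReal.ofReal (h * (δ * Real.sinc (δ / n))) ≤
        eVariationOn (circleCycle x h) (Icc a b) := by
      intro n hn
      have hn' : (0 : ℝ) < n := by exact_mod_cast hn
      set u : ℕ → ℝ := fun i => a + i * ((b - a) / n) with hu
      have hstep : 0 ≤ (b - a) / n := div_nonneg (sub_nonneg.2 hab) hn'.le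
      have hmono : Monotone u := fun i j hij => by
        have : (i : ℝ) ≤ j := by exact_mod_cast hij
        simp only [hu]
        nlinarith
      have hu0 : u 0 = a := by simp [hu]
      have hun : u n = b := by simp only [hu]; field_simp; ring
      have hle := eVariationOn.sum_le_of_monotoneOn_Icc (f := circleCycle x h) (s := Icc a b)
        (m := 0) (n := n) (hmono.monotoneOn _) (fun i hi =>
          ⟨hu0 ▸ hmono hi.1, hun ▸ hmono hi.2⟩)
      refine le_trans ?_ hle
      have hterm : ∀ i : ℕ, ENNReal.ofReal (h * Real.sin (δ / n)) ≤
          edist (circleCycle x h (u (i + 1))) (circleCycle x h (u i)) := fun i => by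
        rw [edist_dist, dist_eq_norm, norm_circleCycle_sub hh]
        refine ENNReal.ofReal_le_ofReal (mul_le_mul_of_nonneg_left ?_ hh.le)
        rw [show (u (i + 1) - u i) / h = δ / n by simp only [hu, hδ]; push_cast; field_simp; ring]
        exact le_abs_self _
      have hs : δ * Real.sinc (δ / n) = n * Real.sin (δ / n) := by
        rcases eq_or_ne δ 0 with h0 | h0
        · simp [h0]
        · rw [Real.sinc_of_ne_zero (div_ne_zero h0 hn'.ne')]; field_simp
      calc ENNReal.ofReal (h * (δ * Real.sinc (δ / n)))
          = n * ENNReal.ofReal (h * Real.sin (δ / n)) := by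
            rw [hs, mul_left_comm, ENNReal.ofReal_mul hn'.le, ENNReal.ofReal_natCast]
        _ = ∑ i ∈ Finset.Ico 0 n, ENNReal.ofReal (h * Real.sin (δ / n)) := by simp
        _ ≤ _ := Finset.sum_le_sum fun i _ => hterm i
    have hlim : Filter.Tendsto (fun n : ℕ => ENNReal.ofReal (h * (δ * Real.sinc (δ / n))))
        Filter.atTop (nhds (ENNReal.ofReal (b - a))) := by
      apply ENNReal.tendsto_ofReal
      have h1 := (Real.continuous_sinc.tendsto 0).comp (tendsto_const_div_atTop_nhds_zero_nat δ)
      have h2 := (h1.const_mul δ).const_mul h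
      rw [Real.sinc_zero, mul_one, hδ, mul_div_cancel₀ _ hh.ne'] at h2
      exact h2
    exact le_of_tendsto hlim (Filter.eventually_atTop.2 ⟨1, fun n hn => hsum n hn⟩)

theorem circleCycle_periodic (x : ℂ) {h : ℝ} (hh : 0 < h) :
    Function.Periodic (circleCycle x h) (Real.pi * h) := fun t => by
  have e : Complex.I * ((2 * (t + Real.pi * h) / h : ℝ) : ℂ) =
      Complex.I * ((2 * t / h : ℝ) : ℂ) + 2 * Real.pi * Complex.I := by
    have : 2 * (t + Real.pi * h) / h = 2 * t / h + 2 * Real.pi := by field_simp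
    rw [this]; push_cast; ring
  rw [circleCycle, circleCycle, e, Complex.exp_add, Complex.exp_two_pi_mul_I, mul_one]

theorem circleCycle_mem_sphere (x : ℂ) {h : ℝ} (hh : 0 < h) (t : ℝ) :
    circleCycle x h t ∈ Metric.sphere x (h / 2) := by
  rw [mem_sphere_iff_norm, circleCycle, add_sub_cancel_left, norm_mul, mul_comm Complex.I,
    Complex.norm_exp_ofReal_mul_I, Complex.norm_real, Real.norm_of_nonneg (by positivity), mul_one]

theorem isConvexCycle_circleCycle (x : ℂ) {h : ℝ} (hh : 0 < h) :
    IsConvexCycle (Metric.closedBall x (h / 2)) (Real.pi * h) (circleCycle x h) where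
  convex := convex_closedBall _ _
  isCompact := isCompact_closedBall _ _
  interior_nonempty := by
    rw [interior_closedBall _ (by positivity)]
    exact Metric.nonempty_ball.2 (by positivity)
  length_pos := by positivity
  periodic := circleCycle_periodic x hh
  injOn := by
    intro s hs t ht e
    have h1 := norm_circleCycle_sub (x := x) hh s t
    rw [e, sub_self, norm_zero, eq_comm, mul_eq_zero, abs_eq_zero] at h1
    have h2 := (Real.sin_eq_zero_iff_of_lt_of_lt
      (by rw [lt_div_iff₀ hh]; linarith [hs.1, ht.2])
      (by rw [div_lt_iff₀ hh]; linarith [ht.1, hs.2])).1 (h1.resolve_left hh.ne')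
    rw [div_eq_zero_iff] at h2
    exact sub_eq_zero.1 (h2.resolve_right hh.ne')
  image_eq := by
    rw [frontier_closedBall _ (by positivity)]
    apply Subset.antisymm
    · rintro _ ⟨t, -, rfl⟩
      exact circleCycle_mem_sphere x hh t
    · intro w hw
      have hpos : 0 < Real.pi * h := by positivity
      obtain ⟨t, ht, e⟩ := (circleCycle_periodic x hh).exists_mem_Ico₀ hpos
        (h / 2 * (w - x).arg)
      refine ⟨t, ht, ?_⟩
      rw [← e, circleCycle, show 2 * (h / 2 * (w - x).arg) / h = (w - x).arg by field_simp,
        mul_comm Complex.I, ← mem_sphere_iff_norm.1 hw, Complex.norm_mul_exp_arg_mul_I]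
      ring
  unitSpeed := hasUnitSpeedOn_circleCycle x hh

theorem hasConstantHalvingDistance_circleCycle (x : ℂ) {h : ℝ} (hh : 0 < h) :
    HasConstantHalvingDistance (Real.pi * h) (circleCycle x h) h := fun t => by
  rw [dist_comm, dist_eq_norm, norm_circleCycle_sub hh,
    show (t + Real.pi * h / 2 - t) / h = Real.pi / 2 by field_simp; ring, Real.sin_pi_div_two]
  simp

theorem lemma10 (h : ℝ) :
    (∀ (K : Set ℂ) (L : ℝ) (c : ℝ → ℂ),
      IsConvexCycle K L c → HasConstantHalvingDistance L c h →
        Integrable (midpointMultiplicity L c) volume ∧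
        volume.real K = Real.pi / 4 * h ^ 2 - 2 * midpointArea L c ∧
        volume.real K ≤ Real.pi / 4 * h ^ 2) ∧
    (0 < h → ∀ x : ℂ, ∃ c : ℝ → ℂ,
      IsConvexCycle (Metric.closedBall x (h / 2)) (Real.pi * h) c ∧
      HasConstantHalvingDistance (Real.pi * h) c h ∧
      volume.real (Metric.closedBall x (h / 2)) = Real.pi / 4 * h ^ 2) := by
  refine ⟨fun K L c hc hh => ⟨hc.integrable_midpointMultiplicity, hc.area_eq hh, hc.area_le hh⟩,
    fun hh x => ⟨circleCycle x h, isConvexCycle_circleCycle x hh,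
      hasConstantHalvingDistance_circleCycle x hh, ?_⟩⟩
  rw [Measure.real, Complex.volume_closedBall, ENNReal.toReal_mul, ENNReal.toReal_pow,
    ENNReal.toReal_ofReal (by positivity)]
  simp
  ring
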